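/- Consider the Navier--Stokes equations on $\mathbb{T}^3=\mathbb{R}^3/(2\pi\mathbb{Z})^3$, $$\mathbf v_t+(\mathbf v,\nabla)\mathbf v=-\nabla p+\nu\Delta\mathbf v,\qquad \operatorname{div}\mathbf v=0,\qquad \mathbf v|_{t=0}=\hat{\mathbf v},\qquad \nu>0.$$ For $f=\sum_{k\in\mathbb Z^3\setminus\{0\}}f_ke^{i(k,x)}$ (zero mean) put $\|f\|^2=\|f\|^2_{H^1(\mathbb T^3)}=\sum_{k\ne0}|f_k|_e^2|k|_e^2$, where $|\cdot|_e$ is the Euclidean norm; let $|x|_m=\max_j|x_j|$ and $|x|=\sum_j|x_j|$ on $\mathbb C^3$, let $\alpha>0$ be a constant with $\alpha|x|_m\le|x|_e$ for all $x\in\mathbb C^3$, and let $$Q(\infty)=\Big\{(t,x)\ \Big|\ |\Im t|<\Re t,\ \tfrac{4}{\nu\alpha}|\Im x|_m<\Re t,\ \Re x\in\mathbb T^3\Big\}.$$ Given $\hat{\mathbf v}\in H^1(\mathbb T^3)$, call $\mathbf v$ a global analytic solution with initial field $\hat{\mathbf v}$ if * $\mathbf v(t,x)=\sum_{k\ne0}\mathbf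 v_k(t)e^{i(k,x)}$ is holomorphic in $Q(\infty)$ and satisfies the first two equations there with some pressure $p$ holomorphic in $Q(\infty)$; * $\mathbf v(0,\cdot)=\hat{\mathbf v}$, and $\|\hat{\mathbf v}-\mathbf v(t,\cdot)\|\to0$ as $t\to0$, $|\Im t|<\Re t$; * there is $V(\tau,x)=\sum_{k\ne 0}V_k(\tau)e^{i(k,x)}\in C([0,\infty),H^1(\mathbb T^3))$ with $\sup_{\tau\ge0}\|V(\tau,\cdot)\|<\infty$ such that $|\mathbf v_k(t)|\le V_k(\Re t)\exp(-\Re t\,|k|_e\nu/2)$ for $|\Im t|<\Re t$ and $k\neq0$. **Proposition.** There is a constant $\mu>0$, depending only on $\nu$, such that for every zero-mean $\hat{\mathbf v}\in H^1(\mathbb T^3)$ with $\operatorname{div}\hat{\mathbf v}=0$ (in the sense of generalized functions) and $\|\hat{\mathbf v}\|\le\mu$ there exists a global analytic solution with initial field $\hat{\mathbf v}$ (real-valued for real $t\ge0$ and real $x$ if $\hat{\mathbf v}$ is real-valued), and for every such global analytic solution $\mathbf v$ there is a constant $c>0$, independent of $t$, with $$\|\mathbf v(t,\cdot)\|\le c\,e^{-\nu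 t/2}\qquad\text{for all }t\ge0.$$ -/

import Mathlib

open MeasureTheory Filter Topology
open scoped ENNReal

namespace NSTorus

noncomputable section

/-- The fundamental cube `(0, 2π]³` of the torus `𝕋³ = ℝ³ / (2πℤ)³`.  Functions on `𝕋³` are
`2π`-periodic functions on `ℝ³`, integrated over this cube. -/
def cube : Set (Fin 3 → ℝ) := Set.univ.pi fun _ => Set.Ioc 0 (2 * Real.pi)

/-- `f` is `2π`-periodic in each of its three real variables. -/
def IsPeriodic {E : Type*} (f : (Fin 3 → ℝ) → E) : Prop :=
  ∀ (x : Fin 3 → ℝ) (j : Fin 3), f (x + Pi.single j (2 * Real.pi)) = f x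

/-- A real point, regarded as a point of `ℂ³`. -/
def toC (x : Fin 3 → ℝ) : Fin 3 → ℂ := fun j => (x j : ℂ)

/-- The exponential `e^{i(k,x)}`, `(k,x) = k₁x₁ + k₂x₂ + k₃x₃`, for `k ∈ ℤ³`, `x ∈ ℂ³`. -/
def expI (k : Fin 3 → ℤ) (x : Fin 3 → ℂ) : ℂ :=
  Complex.exp (Complex.I * ∑ j, (k j : ℂ) * x j)

/-- The Euclidean length `|k|_e` of `k ∈ ℤ³`. -/
def eLen (k : Fin 3 → ℤ) : ℝ := Real.sqrt (∑ j, (k j : ℝ) ^ 2)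

section Sobolev

variable {E : Type*} [NormedAddCommGroup E] [NormedSpace ℂ E]

/-- The Fourier coefficient `f_k = (2π)⁻³ ∫_{𝕋³} f(x) e^{-i(k,x)} dx`. -/
def coeff (f : (Fin 3 → ℝ) → E) (k : Fin 3 → ℤ) : E :=
  ((2 * Real.pi : ℂ) ^ 3)⁻¹ • ∫ x in cube, expI (-k) (toC x) • f x

/-- The `H¹(𝕋³)` norm, `‖f‖² = ∑_{k ≠ 0} |f_k|² |k|_e²`, with values in `[0, ∞]`.
(The term `k = 0` of the sum below vanishes.) -/
def h1Norm (f : (Fin 3 → ℝ) → E) : ℝ≥0∞ :=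
  (∑' k : Fin 3 → ℤ, ENNReal.ofReal (‖coeff f k‖ ^ 2 * eLen k ^ 2)) ^ (1 / 2 : ℝ)

/-- Membership in `H¹(𝕋³)`, the Sobolev space of zero mean value functions. -/
structure MemH1 (f : (Fin 3 → ℝ) → E) : Prop where
  periodic : IsPeriodic f
  memLp : MemLp f 2 (volume.restrict cube)
  zero_mean : ∫ x in cube, f x = 0
  norm_lt_top : h1Norm f < ⊤

/-- `V ∈ C([0,∞), H¹(𝕋³))` with finite norm `sup_{t ≥ 0} ‖V(t,·)‖`. -/
structure MemCH1 (V : ℝ → (Fin 3 → ℝ) → E) : Prop where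
  mem : ∀ t, 0 ≤ t → MemH1 (V t)
  cont : ∀ t, 0 ≤ t → Tendsto (fun s => h1Norm (V s - V t)) (𝓝[Set.Ici 0] t) (𝓝 0)
  bounded : (⨆ t ∈ Set.Ici (0 : ℝ), h1Norm (V t)) < ⊤

end Sobolev

/-- The partial derivative `∂_j f`, over `𝕜 = ℝ` or `𝕜 = ℂ`. -/
def pderiv (𝕜 : Type*) [RCLike 𝕜] [NormedSpace 𝕜 ℂ] (j : Fin 3) (f : (Fin 3 → 𝕜) → ℂ)
    (x : Fin 3 → 𝕜) : ℂ :=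
  fderiv 𝕜 f x (Pi.single j 1)

/-- `div f = 0` on the torus in the sense of generalized functions: `∑_j (f^j, ∂_j φ) = 0` for
all smooth test functions `φ` on `𝕋³`. -/
def WeaklyDivFree (f : (Fin 3 → ℝ) → EuclideanSpace ℂ (Fin 3)) : Prop :=
  ∀ φ : (Fin 3 → ℝ) → ℂ, ContDiff ℝ (⊤ : ℕ∞) φ → IsPeriodic φ →
    ∫ x in cube, ∑ j, f x j * pderiv ℝ j φ x = 0

/-- The sector `|Im t| < Re t` of complex times. -/
def sector : Set ℂ := {t | |t.im| < t.re}

/-- The domain `Q(∞)`: all `(t,x)` with `|Im t| < Re t` and `(4 / (να)) |Im x|_m < Re t`. -/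
def Q (ν α : ℝ) : Set (ℂ × (Fin 3 → ℂ)) :=
  {q | q.1 ∈ sector ∧ ∀ j, 4 / (ν * α) * |(q.2 j).im| < q.1.re}

/-- `v` and `p` satisfy, at each point of `Q(∞)`,
`v_t + (v,∇)v = -∇p + νΔv` and `div v = 0`. -/
def SolvesNS (ν α : ℝ) (v : ℂ → (Fin 3 → ℂ) → EuclideanSpace ℂ (Fin 3))
    (p : ℂ → (Fin 3 → ℂ) → ℂ) : Prop :=
  ∀ t x, (t, x) ∈ Q ν α →
    (∀ j, deriv (fun s => v s x j) t + ∑ l, v t x l * pderiv ℂ l (fun y => v t y j) x =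
      -pderiv ℂ j (p t) x + ν * ∑ l, pderiv ℂ l (pderiv ℂ l fun y => v t y j) x) ∧
    ∑ l, pderiv ℂ l (fun y => v t y l) x = 0

/-- The restriction of a function on `ℂ³` to real `x`. -/
def onReal {E : Type*} (f : (Fin 3 → ℂ) → E) : (Fin 3 → ℝ) → E := fun x => f (toC x)

/-- `v` is a global (`T = ∞`) analytic solution of the initial value problem for the
Navier-Stokes equations with initial field `vhat`, with a majorant `V`. Values of `v` matter only
on `Q(∞)` and, at `t = 0`, at real `x`. -/
structure IsAnalyticSolution (ν α : ℝ) (vhat : (Fin 3 → ℝ) → EuclideanSpace ℂ (Fin 3))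
    (v : ℂ → (Fin 3 → ℂ) → EuclideanSpace ℂ (Fin 3)) : Prop where
  /-- `v ∈ 𝒪(Q(∞))` -/
  holo : DifferentiableOn ℂ (fun q : ℂ × (Fin 3 → ℂ) => v q.1 q.2) (Q ν α)
  /-- `v(t,x) = ∑_{k ≠ 0} v_k(t) e^{i(k,x)}`; so `v` is `2π`-periodic in `x`, with zero mean -/
  expansion : ∀ t x, (t, x) ∈ Q ν α →
    HasSum (fun k : {k : Fin 3 → ℤ // k ≠ 0} => expI k x • coeff (onReal (v t)) k) (v t x)
  /-- the equations hold, with some pressure `p ∈ 𝒪(Q(∞))` that is `2π`-periodic in `x` -/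
  equations : ∃ p : ℂ → (Fin 3 → ℂ) → ℂ,
    DifferentiableOn ℂ (fun q : ℂ × (Fin 3 → ℂ) => p q.1 q.2) (Q ν α) ∧
    (∀ t x, (t, x) ∈ Q ν α → ∀ j, p t (x + Pi.single j (2 * Real.pi : ℂ)) = p t x) ∧
    SolvesNS ν α v p
  /-- `v = vhat` at `t = 0` -/
  initial : ∀ᵐ x : Fin 3 → ℝ, v 0 (toC x) = vhat x
  /-- `‖vhat - v(t,·)‖ → 0` as `t → 0` -/
  initial_lim : Tendsto (fun t => h1Norm (vhat - onReal (v t))) (𝓝[sector] 0) (𝓝 0)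
  /-- `|v_k(t)| ≤ V_k(Re t) exp(-Re t |k|_e ν / 2)`, where `|z| = |z₁| + |z₂| + |z₃|` on `ℂ³` -/
  majorant : ∃ V : ℝ → (Fin 3 → ℝ) → ℂ, MemCH1 V ∧
    ∀ t ∈ sector, ∀ k : Fin 3 → ℤ, k ≠ 0 → (coeff (V t.re) k).im = 0 ∧
      ∑ j, ‖coeff (onReal (v t)) k j‖ ≤
        (coeff (V t.re) k).re * Real.exp (-(t.re * eLen k * ν / 2))

end

end NSTorus

/-! In Fourier variables the equations read `u_k' = -ν|k|² u_k - ∑_l i (k, u_l) P_k u_{k-l}`, with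
`P_k` the Leray projection. They are solved in Duhamel form along the rays `s ↦ st` of the sector,
in the class of coefficients bounded by `A_k exp(-Re t |k| ν / 2)` with `A` independent of `t`. This
weight is submultiplicative because `|k| ≤ |l| + |k - l|`, so convolutions keep it (`decay_mul_le`).
In the Duhamel integral one half of the heat exponent restores the weight, as `|k| ≤ |k|²`, and the
other half is integrated and gains `4/(ν|k|²)` (`norm_duhamel_le`). Since the nonlinearity costs
`2|k|`, everything reduces to the scalar equation `V = a + (8/ν)|k|⁻¹ (V * V)` with `a_k = |v̂_k|`.

The convolution maps weighted `ℓ²` sequences of class `H¹` to `ℓ²`, by Cauchy-Schwarz and the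
convergence of `∑ |k|⁻⁴` (`IsH1Seq.summable_conv_sq`), and `|k|⁻¹` brings the result back to `H¹`.
For small `a` the scalar iterates increase to a limit of class `H¹` (`exists_majorant`). The
increments of the vector iterates are dominated by those of the scalar iterates, so they telescope
and converge to a fixed point (`exists_picard_limit`).

On `Q(∞)` the weight beats the growth of `e^{i(k,x)}`, so the Fourier series can be differentiated
termwise and solves the equations (`Majorized.solvesNS`). Reality passes to the limit from the
iterates. The decay of an arbitrary global analytic solution follows from its majorant alone: `|k| ≥
1` for `k ≠ 0`, so `e^{-νt/2}` factors out. -/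

namespace NSTorus

noncomputable section

/-! ### Wave vectors and the lattice sum. -/

/-- The wave vector `k ∈ ℤ³` as a vector of `ℂ³`. -/
def waveVec (k : Fin 3 → ℤ) : EuclideanSpace ℂ (Fin 3) := WithLp.toLp 2 fun j => (k j : ℂ)

@[simp] lemma waveVec_apply (k : Fin 3 → ℤ) (j : Fin 3) : waveVec k j = k j := rfl

lemma norm_waveVec (k : Fin 3 → ℤ) : ‖waveVec k‖ = eLen k := by
  simp [EuclideanSpace.norm_eq, eLen]

lemma eLen_nonneg (k : Fin 3 → ℤ) : 0 ≤ eLen k := Real.sqrt_nonneg _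

@[simp] lemma eLen_zero : eLen 0 = 0 := by simp [eLen]

lemma eLen_sq (k : Fin 3 → ℤ) : eLen k ^ 2 = ∑ j, (k j : ℝ) ^ 2 :=
  Real.sq_sqrt (Finset.sum_nonneg fun _ _ => sq_nonneg _)

lemma eLen_add_le (k l : Fin 3 → ℤ) : eLen (k + l) ≤ eLen k + eLen l := by
  simp only [← norm_waveVec]
  have : waveVec (k + l) = waveVec k + waveVec l := by ext j; simp
  rw [this]; exact norm_add_le _ _

lemma eLen_neg (k : Fin 3 → ℤ) : eLen (-k) = eLen k := by simp [eLen]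

lemma abs_le_eLen (k : Fin 3 → ℤ) (j : Fin 3) : |(k j : ℝ)| ≤ eLen k := by
  rw [← Real.sqrt_sq_eq_abs]
  exact Real.sqrt_le_sqrt
    (Finset.single_le_sum (f := fun j => (k j : ℝ) ^ 2) (fun _ _ => sq_nonneg _)
      (Finset.mem_univ j))

lemma one_le_eLen {k : Fin 3 → ℤ} (hk : k ≠ 0) : 1 ≤ eLen k := by
  obtain ⟨j, hj⟩ := Function.ne_iff.1 hk
  refine le_trans ?_ (abs_le_eLen k j)
  exact_mod_cast Int.one_le_abs hj

lemma eLen_le_sq (k : Fin 3 → ℤ) : eLen k ≤ eLen k ^ 2 := by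
  rcases eq_or_ne k 0 with rfl | hk
  · simp
  · nlinarith [one_le_eLen hk]

/-- `7/4` is a rational bound for `√3`. Any constant below `2` would serve in
`norm_expI_mul_decay_le`. -/
lemma sum_abs_le_eLen (k : Fin 3 → ℤ) : ∑ j, |(k j : ℝ)| ≤ 7 / 4 * eLen k := by
  refine abs_le_of_sq_le_sq' ?_ (by linarith [eLen_nonneg k]) |>.2
  rw [mul_pow, eLen_sq]
  simp only [Fin.sum_univ_three]
  rw [← sq_abs (k 0 : ℝ), ← sq_abs (k 1 : ℝ), ← sq_abs (k 2 : ℝ)]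
  nlinarith [sq_nonneg (|(k 0 : ℝ)| - |(k 1 : ℝ)|), sq_nonneg (|(k 0 : ℝ)| - |(k 2 : ℝ)|),
    sq_nonneg (|(k 1 : ℝ)| - |(k 2 : ℝ)|)]

/-- The lattice sum `∑ |k|⁻⁴` over `ℤ³ \ {0}` converges. -/
lemma summable_inv_eLen_pow_four : Summable fun k : Fin 3 → ℤ => (eLen k ^ 4)⁻¹ := by
  let b := Pi.basisFun ℝ (Fin 3)
  let L := Submodule.span ℤ (Set.range b)
  have hr : Module.finrank ℤ L = 3 := by
    rw [ZLattice.rank ℝ]; simp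
  have h := ZLattice.summable_norm_pow_inv L 4 (by rw [hr]; norm_num)
  let φ : (Fin 3 → ℤ) → L := fun k =>
    ⟨∑ i, k i • b i, Submodule.sum_mem _ fun i _ =>
      Submodule.smul_mem _ _ (Submodule.subset_span ⟨i, rfl⟩)⟩
  have hφ : ∀ k i, (φ k : Fin 3 → ℝ) i = k i := by
    intro k i
    simp [φ, b, Pi.single_apply]
  have hinj : Function.Injective φ := by
    intro k l hkl
    ext i
    have := congrArg (fun x : L => (x : Fin 3 → ℝ) i) hkl
    simp only [hφ] at this
    exact_mod_cast this
  refine Summable.of_nonneg_of_le (fun k => by have := eLen_nonneg k; positivity) (fun k => ?_)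
    (h.comp_injective hinj)
  -- At `k = 0` the term is `0⁻¹ = 0`. Elsewhere the lattice sum, taken in the sup norm, dominates,
  -- since the sup norm is at most the Euclidean one.
  rcases eq_or_ne k 0 with rfl | hk
  · simp
  have hn : 0 < ‖φ k‖ := by
    rw [norm_pos_iff]
    intro h0
    apply hk
    apply hinj
    rw [h0]; ext i; simp [hφ]
  have hle : ‖φ k‖ ≤ eLen k := by
    rw [Submodule.coe_norm, pi_norm_le_iff_of_nonneg (eLen_nonneg k)]
    intro i
    rw [hφ]; exact abs_le_eLen k i
  simp only [Function.comp_apply, inv_pow]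
  gcongr

/-! ### Convolution of sequences of class `H¹`. -/

/-- Convolution of sequences indexed by `ℤ³`. -/
def conv {R : Type*} [NonUnitalNonAssocSemiring R] [TopologicalSpace R] (A B : (Fin 3 → ℤ) → R)
    (k : Fin 3 → ℤ) : R := ∑' l, A l * B (k - l)

/-- The bijection `(k, l) ↦ (l, k - l)` of `ℤ³ × ℤ³`. -/
def shear : (Fin 3 → ℤ) × (Fin 3 → ℤ) ≃ (Fin 3 → ℤ) × (Fin 3 → ℤ) where
  toFun p := (p.2, p.1 - p.2)
  invFun p := (p.1 + p.2, p.1)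
  left_inv p := by simp
  right_inv p := by simp

section

variable {R : Type*} [NormedRing R] {f g : (Fin 3 → ℤ) → R}

lemma summable_norm_shear (hf : Summable fun k => ‖f k‖) (hg : Summable fun k => ‖g k‖) :
    Summable fun p : (Fin 3 → ℤ) × (Fin 3 → ℤ) => ‖f p.2 * g (p.1 - p.2)‖ := by
  have h : Summable fun p : (Fin 3 → ℤ) × (Fin 3 → ℤ) => ‖f p.1 * g p.2‖ := hf.mul_norm hg
  have := h.comp_injective shear.injective
  simpa only [Function.comp_def, shear, Equiv.coe_fn_mk] using this

lemma hasSum_conv [CompleteSpace R] (hf : Summable fun k => ‖f k‖) (hg : Summable fun k => ‖g k‖) :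
    HasSum (conv f g) ((∑' k, f k) * ∑' k, g k) := by
  have h1 := (summable_norm_shear hf hg)
  have h2 : HasSum (fun p : (Fin 3 → ℤ) × (Fin 3 → ℤ) => f p.2 * g (p.1 - p.2))
      ((∑' k, f k) * ∑' k, g k) := by
    rw [tsum_mul_tsum_of_summable_norm hf hg, ← shear.tsum_eq]
    exact h1.of_norm.hasSum
  exact h2.prod_fiberwise fun k => (h1.of_norm.prod_factor k).hasSum

end

/-- A nonnegative sequence with `A 0 = 0` that is square summable with weight `|k|²`. -/
structure IsH1Seq (A : (Fin 3 → ℤ) → ℝ) : Prop where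
  nonneg : ∀ k, 0 ≤ A k
  zero : A 0 = 0
  summable : Summable fun k => eLen k ^ 2 * A k ^ 2

/-- The square of the `H¹` norm of a sequence. -/
def energy (A : (Fin 3 → ℤ) → ℝ) : ℝ := ∑' k, eLen k ^ 2 * A k ^ 2

lemma energy_nonneg (A : (Fin 3 → ℤ) → ℝ) : 0 ≤ energy A :=
  tsum_nonneg fun _ => by positivity

/-- The constant `∑ |k|⁻⁴`. -/
def latticeSum : ℝ := ∑' k : Fin 3 → ℤ, (eLen k ^ 4)⁻¹

lemma latticeSum_nonneg : 0 ≤ latticeSum :=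
  tsum_nonneg fun k => by have := eLen_nonneg k; positivity

namespace IsH1Seq

variable {A B : (Fin 3 → ℤ) → ℝ}

lemma summable_sq (h : IsH1Seq A) : Summable fun k => A k ^ 2 := by
  refine Summable.of_nonneg_of_le (fun _ => sq_nonneg _) (fun k => ?_) h.summable
  rcases eq_or_ne k 0 with rfl | hk
  · simp [h.zero]
  · have := one_le_eLen hk
    nlinarith [mul_le_mul_of_nonneg_right (one_le_pow₀ this : 1 ≤ eLen k ^ 2) (sq_nonneg (A k))]

lemma summable_sub_sq (h : IsH1Seq A) (k : Fin 3 → ℤ) : Summable fun l => A (k - l) ^ 2 :=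
  (Equiv.subLeft k).summable_iff.2 h.summable_sq

lemma summable_mul (hA : IsH1Seq A) (hB : IsH1Seq B) (k : Fin 3 → ℤ) :
    Summable fun l => A l * B (k - l) := by
  refine Summable.of_nonneg_of_le (fun l => mul_nonneg (hA.nonneg _) (hB.nonneg _)) (fun l => ?_)
    (hA.summable_sq.add (hB.summable_sub_sq k))
  nlinarith [sq_nonneg (A l - B (k - l)), sq_nonneg (A l), sq_nonneg (B (k - l))]

lemma conv_nonneg (hA : IsH1Seq A) (k : Fin 3 → ℤ) : 0 ≤ conv A A k :=
  tsum_nonneg fun _ => mul_nonneg (hA.nonneg _) (hA.nonneg _)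

/-- By `xy ≤ (x² + y²)/2` and invariance of the sum under `l ↦ k - l`. This uniform bound controls
the pressure coefficients. -/
lemma conv_le (hA : IsH1Seq A) (k : Fin 3 → ℤ) : conv A A k ≤ ∑' l, A l ^ 2 := by
  have h2 : ∑' l, A (k - l) ^ 2 = ∑' l, A l ^ 2 :=
    (Equiv.subLeft k).tsum_eq fun l => A l ^ 2
  have : conv A A k ≤ ∑' l, (1 / 2 * A l ^ 2 + 1 / 2 * A (k - l) ^ 2) := by
    refine (hA.summable_mul hA k).tsum_le_tsum (fun l => ?_)
      ((hA.summable_sq.mul_left _).add ((hA.summable_sub_sq k).mul_left _))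
    nlinarith [sq_nonneg (A l - A (k - l))]
  rw [(hA.summable_sq.mul_left _).tsum_add ((hA.summable_sub_sq k).mul_left _),
    tsum_mul_left, tsum_mul_left, h2] at this
  linarith

lemma conv_mono (hA : IsH1Seq A) (hB : IsH1Seq B) (h : ∀ k, A k ≤ B k) (k : Fin 3 → ℤ) :
    conv A A k ≤ conv B B k :=
  (hA.summable_mul hA k).tsum_le_tsum
    (fun _ => mul_le_mul (h _) (h _) (hA.nonneg _) (hB.nonneg _)) (hB.summable_mul hB k)

/-- Cauchy-Schwarz after multiplying and dividing by `|l| |k - l|`, first on finite sets and then in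
the limit. -/
lemma conv_sq_le (hA : IsH1Seq A) (k : Fin 3 → ℤ) :
    conv A A k ^ 2 ≤ latticeSum *
      conv (fun l => eLen l ^ 2 * A l ^ 2) (fun l => eLen l ^ 2 * A l ^ 2) k := by
  have hS := summable_inv_eLen_pow_four
  have hS' : Summable fun l => (eLen (k - l) ^ 4)⁻¹ := (Equiv.subLeft k).summable_iff.2 hS
  have hw : Summable fun l => (eLen l ^ 2 * A l ^ 2) * (eLen (k - l) ^ 2 * A (k - l) ^ 2) := by
    refine ((summable_norm_shear (f := fun l => eLen l ^ 2 * A l ^ 2)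
      (g := fun l => eLen l ^ 2 * A l ^ 2) ?_ ?_).of_norm).prod_factor k <;>
    exact hA.summable.norm
  have key : ∀ s : Finset (Fin 3 → ℤ), (∑ l ∈ s, A l * A (k - l)) ^ 2 ≤ latticeSum *
      conv (fun l => eLen l ^ 2 * A l ^ 2) (fun l => eLen l ^ 2 * A l ^ 2) k := by
    intro s
    have e : ∀ l, A l * A (k - l) = (eLen l * eLen (k - l))⁻¹ *
        (eLen l * A l * (eLen (k - l) * A (k - l))) := by
      intro l
      rcases eq_or_ne l 0 with rfl | hl
      · simp [hA.zero]
      rcases eq_or_ne (k - l) 0 with h0 | hl'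
      · simp [h0, hA.zero]
      have h1 := one_le_eLen hl
      have h2 := one_le_eLen hl'
      field_simp
    simp_rw [e]
    refine (Finset.sum_mul_sq_le_sq_mul_sq _ _ _).trans ?_
    refine mul_le_mul ?_ ?_ (Finset.sum_nonneg fun _ _ => sq_nonneg _) latticeSum_nonneg
    -- The arithmetic-geometric mean inequality splits `|l|⁻² |k - l|⁻²` into two fourth powers,
    -- each summing to `latticeSum` uniformly in `k`.
    · have h1 : ∑ l ∈ s, ((eLen l * eLen (k - l))⁻¹) ^ 2 ≤
          ∑ l ∈ s, (1 / 2 * (eLen l ^ 4)⁻¹ + 1 / 2 * (eLen (k - l) ^ 4)⁻¹) := by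
        refine Finset.sum_le_sum fun l _ => ?_
        have e1 : ∀ x : ℝ, (x ^ 4)⁻¹ = (x⁻¹ ^ 2) ^ 2 := fun x => by rw [← inv_pow]; ring
        rw [e1, e1, mul_inv]
        nlinarith [sq_nonneg ((eLen l)⁻¹ ^ 2 - (eLen (k - l))⁻¹ ^ 2)]
      refine h1.trans ?_
      have hsum := ((hS.mul_left (1 / 2)).add (hS'.mul_left (1 / 2)))
      refine (hsum.sum_le_tsum s fun l _ => ?_).trans ?_
      · have := eLen_nonneg l
        have := eLen_nonneg (k - l)
        positivity
      · have h2 : ∑' l, (eLen (k - l) ^ 4)⁻¹ = latticeSum :=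
          (Equiv.subLeft k).tsum_eq fun l => (eLen l ^ 4)⁻¹
        rw [(hS.mul_left _).tsum_add (hS'.mul_left _), tsum_mul_left, tsum_mul_left, h2,
          ← latticeSum]
        linarith
    · have h2 : ∑ l ∈ s, (eLen l * A l * (eLen (k - l) * A (k - l))) ^ 2 =
          ∑ l ∈ s, (eLen l ^ 2 * A l ^ 2) * (eLen (k - l) ^ 2 * A (k - l) ^ 2) :=
        Finset.sum_congr rfl fun l _ => by ring
      rw [h2]
      exact hw.sum_le_tsum s fun l _ => by positivity
  exact le_of_tendsto ((hA.summable_mul hA k).hasSum.pow 2) (Eventually.of_forall key)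

/-- Summing `conv_sq_le` over `k` turns its right side into a Cauchy product, the square of the
energy. -/
lemma summable_conv_sq (hA : IsH1Seq A) : Summable (fun k => conv A A k ^ 2) ∧
    ∑' k, conv A A k ^ 2 ≤ latticeSum * energy A ^ 2 := by
  have h := (hasSum_conv (f := fun l => eLen l ^ 2 * A l ^ 2) (g := fun l => eLen l ^ 2 * A l ^ 2)
    hA.summable.norm hA.summable.norm).mul_left latticeSum
  have hs := Summable.of_nonneg_of_le (fun _ => sq_nonneg _) hA.conv_sq_le h.summable
  refine ⟨hs, ?_⟩
  rw [energy, sq, ← h.tsum_eq]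
  exact hs.tsum_le_tsum hA.conv_sq_le h.summable

end IsH1Seq

/-! ### The scalar majorant equation. -/

/-- The Picard iterates of the scalar majorant equation `V = a + c |k|⁻¹ (V * V)`. -/
def majorantSeq (c : ℝ) (a : (Fin 3 → ℤ) → ℝ) : ℕ → (Fin 3 → ℤ) → ℝ
  | 0 => 0
  | n + 1 => fun k => a k + c / eLen k * conv (majorantSeq c a n) (majorantSeq c a n) k

section

variable {c : ℝ} {a : (Fin 3 → ℤ) → ℝ}

lemma IsH1Seq.majorant_step (hc : 0 ≤ c) (ha : IsH1Seq a) {A : (Fin 3 → ℤ) → ℝ}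
    (hA : IsH1Seq A) : IsH1Seq (fun k => a k + c / eLen k * conv A A k) ∧
      energy (fun k => a k + c / eLen k * conv A A k) ≤
        2 * energy a + 2 * c ^ 2 * latticeSum * energy A ^ 2 := by
  have hle : ∀ k, eLen k ^ 2 * (a k + c / eLen k * conv A A k) ^ 2 ≤
      2 * (eLen k ^ 2 * a k ^ 2) + 2 * c ^ 2 * conv A A k ^ 2 := by
    intro k
    rcases eq_or_ne k 0 with rfl | hk
    · simp only [eLen_zero]
      have := sq_nonneg (c * conv A A 0)
      nlinarith
    · have h1 := one_le_eLen hk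
      have : eLen k ^ 2 * (a k + c / eLen k * conv A A k) ^ 2 =
          (eLen k * a k + c * conv A A k) ^ 2 := by
        field_simp
      rw [this]
      nlinarith [sq_nonneg (eLen k * a k - c * conv A A k)]
  obtain ⟨h1, h2⟩ := hA.summable_conv_sq
  have hs := (ha.summable.mul_left 2).add (h1.mul_left (2 * c ^ 2))
  have hs' := Summable.of_nonneg_of_le (fun k => by positivity) hle hs
  -- The zero mode stays zero because `c / eLen 0 = 0`.
  refine ⟨⟨fun k => ?_, by simp [ha.zero], hs'⟩, ?_⟩
  · exact add_nonneg (ha.nonneg k)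
      (mul_nonneg (div_nonneg hc (eLen_nonneg k)) (hA.conv_nonneg k))
  · refine (hs'.tsum_le_tsum hle hs).trans ?_
    rw [(ha.summable.mul_left 2).tsum_add (h1.mul_left (2 * c ^ 2)), tsum_mul_left, tsum_mul_left,
      ← energy]
    nlinarith [mul_le_mul_of_nonneg_left h2 (by positivity : 0 ≤ 2 * c ^ 2)]

lemma isH1Seq_zero : IsH1Seq 0 :=
  ⟨fun _ => le_rfl, rfl, by simp⟩

/-- The ball of energy `4E`, `E = energy a`, is invariant: `2E + 2c²S(4E)² ≤ 4E` is the smallness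
condition `16c²SE ≤ 1`, with `S = latticeSum`. -/
lemma isH1Seq_majorantSeq (hc : 0 ≤ c) (ha : IsH1Seq a)
    (hs : 16 * c ^ 2 * latticeSum * energy a ≤ 1) (n : ℕ) :
    IsH1Seq (majorantSeq c a n) ∧ energy (majorantSeq c a n) ≤ 4 * energy a := by
  induction n with
  | zero =>
    refine ⟨isH1Seq_zero, ?_⟩
    have : energy (majorantSeq c a 0) = 0 := by simp [energy, majorantSeq]
    rw [this]
    linarith [energy_nonneg a]
  | succ n ih =>
    obtain ⟨h1, h2⟩ := ha.majorant_step hc ih.1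
    refine ⟨h1, h2.trans ?_⟩
    have h3 : energy (majorantSeq c a n) ^ 2 ≤ (4 * energy a) ^ 2 :=
      pow_le_pow_left₀ (energy_nonneg _) ih.2 2
    have h4 : 0 ≤ 2 * c ^ 2 * latticeSum := by have := latticeSum_nonneg; positivity
    nlinarith [mul_le_mul_of_nonneg_left h3 h4, energy_nonneg a,
      mul_le_mul_of_nonneg_right hs (energy_nonneg a)]

/-- The step is monotone on nonnegative sequences and the iteration starts at `0`. Smallness enters
through the convergence of the convolutions being compared. -/
lemma majorantSeq_mono (hc : 0 ≤ c) (ha : IsH1Seq a)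
    (hs : 16 * c ^ 2 * latticeSum * energy a ≤ 1) (k : Fin 3 → ℤ) :
    Monotone fun n => majorantSeq c a n k := by
  refine monotone_nat_of_le_succ fun n => ?_
  induction n generalizing k with
  | zero => exact (isH1Seq_majorantSeq hc ha hs 1).1.nonneg k
  | succ n ih =>
    have := (isH1Seq_majorantSeq hc ha hs n).1.conv_mono (isH1Seq_majorantSeq hc ha hs (n + 1)).1
      ih k
    simp only [majorantSeq] at this ⊢
    have h0 := div_nonneg hc (eLen_nonneg k)
    gcongr

/-- For small data, the iterates of the majorant equation converge. -/
lemma exists_majorant (hc : 0 ≤ c) (ha : IsH1Seq a)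
    (hs : 16 * c ^ 2 * latticeSum * energy a ≤ 1) :
    ∃ V, IsH1Seq V ∧ (∀ n k, majorantSeq c a n k ≤ V k) ∧
      (∀ k, Tendsto (fun n => majorantSeq c a n k) atTop (𝓝 (V k))) ∧
      ∀ k, Tendsto (fun n => conv (majorantSeq c a n) (majorantSeq c a n) k) atTop
        (𝓝 (conv V V k)) := by
  have hW := isH1Seq_majorantSeq hc ha hs
  have hterm : ∀ n k, eLen k ^ 2 * majorantSeq c a n k ^ 2 ≤ 4 * energy a := fun n k =>
    ((hW n).1.summable.le_tsum k fun _ _ => by positivity).trans (hW n).2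
  have hbdd : ∀ k, BddAbove (Set.range fun n => majorantSeq c a n k) := by
    intro k
    -- From `x ≤ x² + 1` and `x² ≤ |k|² x² ≤ 4 energy a`.
    refine ⟨4 * energy a + 1, ?_⟩
    rintro _ ⟨n, rfl⟩
    rcases eq_or_ne k 0 with rfl | hk
    · simp only [(hW n).1.zero]; linarith [energy_nonneg a]
    · have h1 := one_le_eLen hk
      have h2 : (1 : ℝ) ≤ eLen k ^ 2 := one_le_pow₀ h1
      have h3 := mul_le_mul_of_nonneg_right h2 (sq_nonneg (majorantSeq c a n k))
      nlinarith [hterm n k, sq_nonneg (majorantSeq c a n k - 1)]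
  have hlim : ∀ k, Tendsto (fun n => majorantSeq c a n k) atTop
      (𝓝 (⨆ n, majorantSeq c a n k)) := fun k =>
    tendsto_atTop_ciSup (majorantSeq_mono hc ha hs k) (hbdd k)
  have hle : ∀ n k, majorantSeq c a n k ≤ ⨆ n, majorantSeq c a n k := fun n k =>
    le_ciSup (hbdd k) n
  have hV : IsH1Seq fun k => ⨆ n, majorantSeq c a n k := by
    refine ⟨fun k => ((hW 0).1.nonneg k).trans (hle 0 k), ?_, ?_⟩
    · simp [(hW _).1.zero]
    -- A Fatou argument: the uniform energy bound passes to the limit on finite sets of modes.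
    · refine summable_of_sum_le (c := 4 * energy a) (fun _ => by positivity) fun s => ?_
      refine le_of_tendsto (tendsto_finsetSum s fun k _ => ((hlim k).pow 2).const_mul _)
        (Eventually.of_forall fun n => ?_)
      exact ((hW n).1.summable.sum_le_tsum s fun _ _ => by positivity).trans (hW n).2
  refine ⟨_, hV, hle, hlim, fun k => ?_⟩
  refine tendsto_tsum_of_dominated_convergence (hV.summable_mul hV k)
    (fun l => (hlim l).mul (hlim (k - l))) (Eventually.of_forall fun n l => ?_)
  rw [Real.norm_of_nonneg (mul_nonneg ((hW n).1.nonneg _) ((hW n).1.nonneg _))]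
  exact mul_le_mul (hle _ _) (hle _ _) ((hW n).1.nonneg _) (hV.nonneg _)

end

/-! ### The sector of complex times and the Duhamel integral. -/

lemma isOpen_sector : IsOpen sector :=
  isOpen_lt (continuous_abs.comp Complex.continuous_im) Complex.continuous_re

lemma re_pos_of_mem_sector {t : ℂ} (ht : t ∈ sector) : 0 < t.re :=
  (abs_nonneg _).trans_lt ht

lemma norm_le_of_mem_sector {t : ℂ} (ht : t ∈ sector) : ‖t‖ ≤ 2 * t.re := by
  have h := Complex.norm_le_abs_re_add_abs_im t
  have h1 : |t.im| < t.re := ht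
  rw [abs_of_pos (re_pos_of_mem_sector ht)] at h
  linarith

lemma smul_mem_sector {t : ℂ} (ht : t ∈ sector) {s : ℝ} (hs : 0 < s) : (s : ℂ) * t ∈ sector := by
  have h1 : |t.im| < t.re := ht
  simp only [sector, Set.mem_ofPred_eq, Complex.mul_im, Complex.mul_re, Complex.ofReal_re,
    Complex.ofReal_im, zero_mul, add_zero, sub_zero, abs_mul, abs_of_pos hs]
  gcongr

lemma ofReal_mem_sector {t : ℝ} (ht : 0 < t) : (t : ℂ) ∈ sector := by
  simpa [sector] using ht

/-- A displacement of length `r` can lower `Re` and raise `|Im|` by `r` each, hence the factor `2`.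
-/
lemma mem_sector_of_dist_lt {t z : ℂ} {r : ℝ} (h : 2 * r ≤ t.re - |t.im|) (hz : dist z t < r) :
    z ∈ sector ∧ z.re ≤ t.re + r := by
  rw [Complex.dist_eq] at hz
  have h1 := (Complex.abs_re_le_norm (z - t)).trans_lt hz
  have h2 := (Complex.abs_im_le_norm (z - t)).trans_lt hz
  rw [Complex.sub_re, abs_lt] at h1
  rw [Complex.sub_im] at h2
  have h3 := abs_sub_abs_le_abs_sub z.im t.im
  refine ⟨?_, by linarith⟩
  change |z.im| < z.re
  linarith

section

variable {F : Type*} [NormedAddCommGroup F] [NormedSpace ℂ F]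

/-- Along the rays of the sector, a holomorphic function that is bounded near the vertex has the
primitive `∫₀¹ t G(st) ds`. -/
lemma hasDerivAt_rayPrimitive [CompleteSpace F] {G : ℂ → F} (hG : DifferentiableOn ℂ G sector)
    (hb : ∀ R : ℝ, ∃ M : ℝ, ∀ t ∈ sector, t.re ≤ R → ‖G t‖ ≤ M) {t : ℂ} (ht : t ∈ sector) :
    HasDerivAt (fun z : ℂ => ∫ s in (0 : ℝ)..1, z • G (s * z)) (G t) t := by
  -- With a quarter of the gap, every `z` within `r` of `t` still has gap at least `2r`, so a disc
  -- of radius `r` about `z` remains in the sector.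
  set r : ℝ := (t.re - |t.im|) / 4 with hr
  have hr0 : 0 < r := by
    have : |t.im| < t.re := ht
    rw [hr]; linarith
  obtain ⟨M, hM⟩ := hb (t.re + 2 * r)
  have hM0 : 0 ≤ M := (norm_nonneg _).trans (hM t ht (by linarith))
  have hball : ∀ z ∈ Metric.ball t r, z ∈ sector ∧ z.re ≤ t.re + r ∧ 2 * r ≤ z.re - |z.im| := by
    intro z hz
    have hz' : dist z t < r := hz
    obtain ⟨h1, h2⟩ := mem_sector_of_dist_lt (by linarith) hz'
    refine ⟨h1, h2, ?_⟩
    rw [Complex.dist_eq] at hz'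
    have h3 := (Complex.abs_re_le_norm (z - t)).trans_lt hz'
    have h4 := (Complex.abs_im_le_norm (z - t)).trans_lt hz'
    rw [Complex.sub_re, abs_lt] at h3
    rw [Complex.sub_im] at h4
    have h5 := abs_sub_abs_le_abs_sub z.im t.im
    linarith
  have hderiv : ∀ z ∈ sector, HasDerivAt G (deriv G z) z := fun z hz =>
    (hG.differentiableAt (isOpen_sector.mem_nhds hz)).hasDerivAt
  have hcontG : ∀ z ∈ sector, ContinuousOn (fun s : ℝ => G (s * z)) (Set.Ioc 0 1) := fun z hz =>
    hG.continuousOn.comp (by fun_prop) fun s hs => smul_mem_sector hz hs.1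
  have hcontG' : ContinuousOn (fun s : ℝ => deriv G (s * t)) (Set.Ioc 0 1) :=
    (hG.deriv isOpen_sector).continuousOn.comp (by fun_prop) fun s hs => smul_mem_sector ht hs.1
  have hGM : ∀ z ∈ Metric.ball t r, ∀ s : ℝ, s ∈ Set.Ioc 0 1 → ‖G (s * z)‖ ≤ M := by
    intro z hz s hs
    obtain ⟨h1, h2, h3⟩ := hball z hz
    refine hM _ (smul_mem_sector h1 hs.1) ?_
    simp only [Complex.mul_re, Complex.ofReal_re, Complex.ofReal_im, zero_mul, sub_zero]
    have := re_pos_of_mem_sector h1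
    nlinarith [hs.2]
  -- Cauchy's estimate on the disc of radius `sr` about `sz`, which lies in the sector by
  -- homogeneity. The singularity `1/s` is cancelled by the factor `s` from the chain rule.
  have hG'M : ∀ z ∈ Metric.ball t r, ∀ s : ℝ, s ∈ Set.Ioc 0 1 →
      ‖deriv G (s * z)‖ ≤ 2 * M / (s * r) := by
    intro z hz s hs
    obtain ⟨h1, h2, h3⟩ := hball z hz
    have hsub : ∀ w ∈ Metric.ball ((s : ℂ) * z) (s * r), w ∈ sector ∧ ‖G w‖ ≤ M := by
      intro w hw
      have := mem_sector_of_dist_lt (t := (s : ℂ) * z) (z := w) (r := s * r) (by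
        simp only [Complex.mul_re, Complex.mul_im, Complex.ofReal_re, Complex.ofReal_im, zero_mul,
          sub_zero, add_zero, abs_mul, abs_of_pos hs.1]
        nlinarith [hs.1]) hw
      refine ⟨this.1, hM _ this.1 (this.2.trans ?_)⟩
      simp only [Complex.mul_re, Complex.ofReal_re, Complex.ofReal_im, zero_mul, sub_zero]
      have := re_pos_of_mem_sector h1
      nlinarith [hs.2]
    refine Complex.norm_deriv_le_div_of_mapsTo_ball (R₁ := s * r) (R₂ := 2 * M)
      (hG.mono fun w hw => (hsub w hw).1) (fun w hw => ?_) (mul_pos hs.1 hr0)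
    rw [Metric.mem_closedBall, dist_eq_norm]
    refine (norm_sub_le _ _).trans ?_
    linarith [(hsub w hw).2, hGM z hz s hs]
  have hIoc : Set.uIoc (0 : ℝ) 1 = Set.Ioc 0 1 := Set.uIoc_of_le zero_le_one
  have key := intervalIntegral.hasDerivAt_integral_of_dominated_loc_of_deriv_le
    (μ := volume) (a := (0 : ℝ)) (b := 1) (x₀ := t) (s := Metric.ball t r)
    (F := fun (z : ℂ) (s : ℝ) => z • G (s * z))
    (F' := fun (z : ℂ) (s : ℝ) => z • ((s : ℂ) • deriv G (s * z)) + G (s * z))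
    (bound := fun _ => (t.re + r) * 2 * (2 * M / r) + M) (Metric.ball_mem_nhds _ hr0)
    (by
      filter_upwards [Metric.ball_mem_nhds t hr0] with z hz
      rw [hIoc]
      exact ((hcontG z (hball z hz).1).const_smul z).aestronglyMeasurable measurableSet_Ioc)
    (by
      rw [intervalIntegrable_iff, hIoc]
      refine IntegrableOn.of_bound (C := ‖t‖ * M) (by simp)
        (((hcontG t ht).const_smul t).aestronglyMeasurable measurableSet_Ioc) ?_
      refine (ae_restrict_iff' measurableSet_Ioc).2 (Eventually.of_forall fun s hs => ?_)
      rw [norm_smul]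
      gcongr
      exact hGM t (Metric.mem_ball_self hr0) s hs)
    (by
      rw [hIoc]
      refine ContinuousOn.aestronglyMeasurable ?_ measurableSet_Ioc
      refine ContinuousOn.add (ContinuousOn.const_smul ?_ _) (hcontG t ht)
      exact ContinuousOn.smul (by fun_prop) hcontG')
    (by
      refine Eventually.of_forall fun s hs z hz => ?_
      rw [hIoc] at hs
      refine (norm_add_le _ _).trans (add_le_add ?_ (hGM z hz s hs))
      rw [norm_smul, norm_smul, Complex.norm_real, Real.norm_of_nonneg hs.1.le]
      have h1 := hG'M z hz s hs
      have h2 := norm_le_of_mem_sector (hball z hz).1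
      have h3 : s * ‖deriv G (s * z)‖ ≤ 2 * M / r := by
        calc s * ‖deriv G (s * z)‖ ≤ s * (2 * M / (s * r)) :=
              mul_le_mul_of_nonneg_left h1 hs.1.le
          _ = 2 * M / r := by have := hs.1.ne'; field_simp
      have h4 : ‖z‖ ≤ (t.re + r) * 2 := by linarith [(hball z hz).2.1]
      exact mul_le_mul h4 h3 (mul_nonneg hs.1.le (norm_nonneg _)) ((norm_nonneg _).trans h4))
    (by simp)
    (by
      refine Eventually.of_forall fun s hs z hz => ?_
      rw [hIoc] at hs
      have h1 : HasDerivAt (fun z : ℂ => G (s * z)) ((s : ℂ) • deriv G (s * z)) z := by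
        have := (hderiv _ (smul_mem_sector (hball z hz).1 hs.1)).scomp z
          ((hasDerivAt_id z).const_mul (s : ℂ))
        simpa [Function.comp_def] using this
      simpa using (hasDerivAt_id z).fun_smul h1)
  -- The integrand is the derivative in `s` of `s G(st)`, which tends to `0` as `s → 0` because `G`
  -- is bounded there.
  have hval : ∫ s in (0 : ℝ)..1, (t • ((s : ℂ) • deriv G (s * t)) + G (s * t)) = G t - 0 := by
    refine intervalIntegral.integral_eq_sub_of_hasDerivAt_of_tendsto (f := fun s : ℝ =>
      (s : ℂ) • G (s * t)) zero_lt_one (fun s hs => ?_) key.1 ?_ ?_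
    · have h3 : HasDerivAt (fun s : ℝ => (s : ℂ)) 1 s := Complex.ofRealCLM.hasDerivAt
      have h1 : HasDerivAt (fun s : ℝ => G (s * t)) (t • deriv G (s * t)) s := by
        have h2 : HasDerivAt (fun s : ℝ => (s : ℂ) * t) t s := by
          simpa using h3.mul_const t
        simpa [Function.comp_def] using
          (hderiv _ (smul_mem_sector ht hs.1)).scomp (𝕜 := ℝ) s h2
      have := h3.fun_smul h1
      rw [smul_comm t]
      simpa using this
    · have : Tendsto (fun s : ℝ => s * M) (𝓝[>] 0) (𝓝 0) := by
        have h : Continuous fun s : ℝ => s * M := by fun_prop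
        simpa using (h.tendsto 0).mono_left nhdsWithin_le_nhds
      refine squeeze_zero_norm' ?_ this
      filter_upwards [Ioc_mem_nhdsGT (zero_lt_one (α := ℝ))] with s hs
      rw [norm_smul, Complex.norm_real, Real.norm_of_nonneg hs.1.le]
      exact mul_le_mul_of_nonneg_left (hGM t (Metric.mem_ball_self hr0) s hs) hs.1.le
    · have h1 : ContinuousWithinAt (fun s : ℝ => (s : ℂ) • G (s * t)) (Set.Ioc 0 1) 1 :=
        (ContinuousOn.smul (by fun_prop) (hcontG t ht)) 1 (by simp)
      have h2 := h1.tendsto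
      simp only [Complex.ofReal_one, one_smul, one_mul] at h2
      refine h2.mono_left ?_
      rw [← nhdsWithin_Ioo_eq_nhdsLT (zero_lt_one (α := ℝ))]
      exact nhdsWithin_mono _ Set.Ioo_subset_Ioc_self
  rw [sub_zero] at hval
  rw [← hval]
  exact key.2

/-- The Duhamel integral `∫₀ᵗ e^{-λ(t-s)} g(s) ds` along the ray from `0` to `t`. -/
def duhamel (lam : ℝ) (g : ℂ → F) (t : ℂ) : F :=
  ∫ s in (0 : ℝ)..1, t • Complex.exp (-(lam * t * (1 - s))) • g (s * t)

/-- The decay factor `exp(-Re t |k| ν / 2)`. -/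
def decay (ν : ℝ) (k : Fin 3 → ℤ) (t : ℂ) : ℝ := Real.exp (-(t.re * eLen k * ν / 2))

lemma decay_pos (ν : ℝ) (k : Fin 3 → ℤ) (t : ℂ) : 0 < decay ν k t := Real.exp_pos _

lemma decay_le_one {ν : ℝ} (hν : 0 < ν) (k : Fin 3 → ℤ) {t : ℂ} (ht : t ∈ sector) :
    decay ν k t ≤ 1 := by
  have := re_pos_of_mem_sector ht
  have := eLen_nonneg k
  rw [decay, Real.exp_le_one_iff]
  have : 0 ≤ t.re * eLen k * ν / 2 := by positivity
  linarith

/-- The triangle inequality for `|·|_e`. This is why the exponent of the weight is linear in `|k|`.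
-/
lemma decay_mul_le {ν : ℝ} (hν : 0 < ν) (k l : Fin 3 → ℤ) {t : ℂ} (ht : t ∈ sector) :
    decay ν l t * decay ν (k - l) t ≤ decay ν k t := by
  rw [decay, decay, decay, ← Real.exp_add, Real.exp_le_exp]
  have h := eLen_add_le l (k - l)
  rw [add_sub_cancel] at h
  have := mul_le_mul_of_nonneg_left h (mul_pos (re_pos_of_mem_sector ht) hν).le
  linarith

/-- Holomorphic functions on the sector bounded by `M exp(-Re t |k| ν / 2)`. -/
structure DecayBound (ν : ℝ) (k : Fin 3 → ℤ) (M : ℝ) (g : ℂ → F) : Prop where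
  holo : DifferentiableOn ℂ g sector
  bound : ∀ t ∈ sector, ‖g t‖ ≤ M * decay ν k t

variable {ν : ℝ} {k : Fin 3 → ℤ} {M : ℝ} {g : ℂ → F}

lemma DecayBound.nonneg (h : DecayBound ν k M g) : 0 ≤ M := by
  have h1 := (norm_nonneg _).trans (h.bound _ (ofReal_mem_sector one_pos))
  exact nonneg_of_mul_nonneg_left h1 (decay_pos _ _ _)

lemma DecayBound.norm_le (hν : 0 < ν) (h : DecayBound ν k M g) {t : ℂ} (ht : t ∈ sector) :
    ‖g t‖ ≤ M :=
  (h.bound t ht).trans (mul_le_of_le_one_right h.nonneg (decay_le_one hν k ht))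

lemma norm_exp_neg_le_one {lam : ℝ} (hlam : 0 ≤ lam) {t : ℂ} (ht : t ∈ sector) {s : ℝ}
    (hs : s ≤ 1) : ‖Complex.exp (-(lam * t * (1 - s)))‖ ≤ 1 := by
  rw [Complex.norm_exp, Real.exp_le_one_iff]
  have h := re_pos_of_mem_sector ht
  simp only [Complex.neg_re, Complex.mul_re, Complex.mul_im, Complex.ofReal_re, Complex.ofReal_im,
    Complex.sub_re, Complex.sub_im, Complex.one_re, Complex.one_im, zero_mul, sub_zero, mul_zero,
    sub_self, add_zero]
  have : 0 ≤ lam * t.re * (1 - s) := by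
    have : 0 ≤ 1 - s := by linarith
    positivity
  linarith

lemma intervalIntegrable_duhamel (hν : 0 < ν) {lam : ℝ} (hlam : 0 ≤ lam)
    (h : DecayBound ν k M g) {t : ℂ} (ht : t ∈ sector) :
    IntervalIntegrable (fun s : ℝ => t • Complex.exp (-(lam * t * (1 - s))) • g (s * t))
      volume 0 1 := by
  rw [intervalIntegrable_iff, Set.uIoc_of_le zero_le_one]
  refine IntegrableOn.of_bound (C := ‖t‖ * M) (by simp)
    (ContinuousOn.aestronglyMeasurable ?_ measurableSet_Ioc) ?_
  · refine ContinuousOn.const_smul (ContinuousOn.smul (by fun_prop) ?_) _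
    exact h.holo.continuousOn.comp (by fun_prop) fun s hs => smul_mem_sector ht hs.1
  · refine (ae_restrict_iff' measurableSet_Ioc).2 (Eventually.of_forall fun s hs => ?_)
    rw [norm_smul, norm_smul]
    gcongr
    have h1 := norm_exp_neg_le_one hlam ht hs.2
    have h2 := h.norm_le hν (smul_mem_sector ht hs.1)
    calc _ ≤ 1 * M := mul_le_mul h1 h2 (norm_nonneg _) zero_le_one
      _ = M := one_mul M

lemma duhamel_sub (hν : 0 < ν) {lam : ℝ} (hlam : 0 ≤ lam) {M' : ℝ} {g' : ℂ → F}
    (h : DecayBound ν k M g) (h' : DecayBound ν k M' g') {t : ℂ} (ht : t ∈ sector) :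
    duhamel lam g t - duhamel lam g' t = duhamel lam (fun s => g s - g' s) t := by
  rw [duhamel, duhamel, ← intervalIntegral.integral_sub (intervalIntegrable_duhamel hν hlam h ht)
    (intervalIntegrable_duhamel hν hlam h' ht), duhamel]
  simp only [smul_sub]

/-- A crude bound whose factor `‖t‖` yields the initial condition as `t → 0`. -/
lemma norm_duhamel_le_const (hν : 0 < ν) {lam : ℝ} (hlam : 0 ≤ lam)
    (h : DecayBound ν k M g) {t : ℂ} (ht : t ∈ sector) : ‖duhamel lam g t‖ ≤ ‖t‖ * M := by
  have := intervalIntegral.norm_integral_le_of_norm_le_const (a := (0 : ℝ)) (b := 1)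
    (f := fun s : ℝ => t • Complex.exp (-(lam * t * (1 - s))) • g (s * t)) (C := ‖t‖ * M)
    fun s hs => by
      rw [Set.uIoc_of_le zero_le_one] at hs
      rw [norm_smul, norm_smul]
      have h1 := norm_exp_neg_le_one hlam ht hs.2
      have h2 := h.norm_le hν (smul_mem_sector ht hs.1)
      gcongr
      calc _ ≤ 1 * M := mul_le_mul h1 h2 (norm_nonneg _) zero_le_one
        _ = M := one_mul M
  simpa [duhamel] using this

/-- Half of the heat exponent pays for replacing the weight at `st` by the weight at `t`. The other
half is integrated over `s`, and `‖t‖ ≤ 2 Re t` gives the constant `4`. -/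
lemma norm_duhamel_le (hν : 0 < ν) (hk : k ≠ 0)
    (hM : ∀ t ∈ sector, ‖g t‖ ≤ M * decay ν k t) {t : ℂ} (ht : t ∈ sector) :
    ‖duhamel (ν * eLen k ^ 2) g t‖ ≤ 4 / (ν * eLen k ^ 2) * M * decay ν k t := by
  have hk1 := one_le_eLen hk
  have hτ := re_pos_of_mem_sector ht
  have hM0 : 0 ≤ M :=
    nonneg_of_mul_nonneg_left ((norm_nonneg _).trans (hM t ht)) (decay_pos _ _ _)
  set lam := ν * eLen k ^ 2 with hlamdef
  have hlam : 0 < lam := by positivity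
  set c := lam * t.re / 2 with hc
  set C := 4 / lam * M * decay ν k t with hC
  have hC0 : 0 ≤ C := mul_nonneg (mul_nonneg (by positivity) hM0) (decay_pos _ _ _).le
  -- An explicit primitive of the final bound: `C * c` equals `2 Re t · M` times the weight at `t`.
  have hd : ∀ s : ℝ, HasDerivAt (fun s : ℝ => C * Real.exp (-(c * (1 - s))))
      (C * (c * Real.exp (-(c * (1 - s))))) s := by
    intro s
    have h1 : HasDerivAt (fun s : ℝ => -(c * (1 - s))) c s := by
      simpa using (((hasDerivAt_id s).const_sub 1).const_mul c).fun_neg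
    convert! (h1.exp).const_mul C using 1
    ring
  have hcont : Continuous fun s : ℝ => C * (c * Real.exp (-(c * (1 - s)))) := by fun_prop
  have hint : ∫ s in (0 : ℝ)..1, C * (c * Real.exp (-(c * (1 - s)))) ≤ C := by
    rw [intervalIntegral.integral_eq_sub_of_hasDerivAt (fun s _ => hd s)
      (hcont.intervalIntegrable _ _)]
    have : 0 ≤ C * Real.exp (-(c * (1 - 0))) := by positivity
    simp only [sub_self, mul_zero, neg_zero, Real.exp_zero, mul_one] at this ⊢
    linarith
  refine le_trans ?_ hint
  refine intervalIntegral.norm_integral_le_of_norm_le zero_le_one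
    (Eventually.of_forall fun s hs => ?_) (hcont.intervalIntegrable _ _)
  rw [norm_smul, norm_smul, Complex.norm_exp]
  have e1 : (-((lam : ℂ) * t * (1 - s))).re = -(lam * t.re * (1 - s)) := by
    simp
  have h2 := hM _ (smul_mem_sector ht hs.1)
  have e2 : Real.exp (-(lam * t.re * (1 - s))) * decay ν k (s * t) ≤
      Real.exp (-(c * (1 - s))) * decay ν k t := by
    rw [decay, decay, ← Real.exp_add, ← Real.exp_add, Real.exp_le_exp]
    simp only [Complex.mul_re, Complex.ofReal_re, Complex.ofReal_im, zero_mul, sub_zero]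
    have h3 : t.re * ν * (1 - s) * eLen k ≤ t.re * ν * (1 - s) * eLen k ^ 2 :=
      mul_le_mul_of_nonneg_left (eLen_le_sq k)
        (mul_nonneg (mul_nonneg hτ.le hν.le) (by linarith [hs.2]))
    rw [hc, hlamdef]
    nlinarith
  rw [e1]
  calc ‖t‖ * (Real.exp (-(lam * t.re * (1 - s))) * ‖g (s * t)‖)
      ≤ (2 * t.re) * (Real.exp (-(lam * t.re * (1 - s))) * (M * decay ν k (s * t))) := by
        gcongr
        exact norm_le_of_mem_sector ht
    _ = (2 * t.re * M) * (Real.exp (-(lam * t.re * (1 - s))) * decay ν k (s * t)) := by ring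
    _ ≤ (2 * t.re * M) * (Real.exp (-(c * (1 - s))) * decay ν k t) := by gcongr
    _ = C * (c * Real.exp (-(c * (1 - s)))) := by
        rw [hC, hc]; field_simp; ring

lemma hasDerivAt_duhamel [CompleteSpace F] (hν : 0 < ν) {lam : ℝ} (hlam : 0 ≤ lam)
    (h : DecayBound ν k M g) {t : ℂ} (ht : t ∈ sector) :
    HasDerivAt (duhamel lam g) (-(lam : ℂ) • duhamel lam g t + g t) t := by
  -- Variation of constants: `e^{-λz}` times the ray primitive of `e^{λw} g(w)`.
  have e : ∀ z, duhamel lam g z = Complex.exp (-(lam * z)) •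
      ∫ s in (0 : ℝ)..1, z • (Complex.exp (lam * (s * z)) • g (s * z)) := by
    intro z
    rw [duhamel, ← intervalIntegral.integral_smul]
    refine intervalIntegral.integral_congr fun s _ => ?_
    rw [smul_comm _ z, smul_smul (Complex.exp _) (Complex.exp _), ← Complex.exp_add]
    congr 3
    ring_nf
  have hp := hasDerivAt_rayPrimitive (G := fun w => Complex.exp (lam * w) • g w) (t := t)
    (DifferentiableOn.smul (by fun_prop) h.holo) (fun R => ⟨Real.exp (lam * R) * M, fun z hz hR => by
      rw [norm_smul, Complex.norm_exp]
      have h1 := h.norm_le hν hz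
      have h2 : ((lam : ℂ) * z).re ≤ lam * R := by
        simp only [Complex.mul_re, Complex.ofReal_re, Complex.ofReal_im, zero_mul, sub_zero]
        gcongr
      gcongr⟩) ht
  have he : HasDerivAt (fun z : ℂ => Complex.exp (-(lam * z)))
      (-(lam : ℂ) * Complex.exp (-(lam * t))) t := by
    have h1 : HasDerivAt (fun z : ℂ => -((lam : ℂ) * z)) (-(lam : ℂ)) t := by
      simpa using ((hasDerivAt_id t).const_mul (lam : ℂ)).fun_neg
    convert! h1.cexp using 1
    ring
  have := he.fun_smul hp
  have hfun : duhamel lam g = fun z => Complex.exp (-(lam * z)) •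
      ∫ s in (0 : ℝ)..1, z • (Complex.exp (lam * (s * z)) • g (s * z)) := funext e
  rw [hfun]
  convert! this using 1
  rw [smul_smul, smul_smul, ← Complex.exp_add, neg_add_cancel, Complex.exp_zero, one_smul, add_comm]

end

/-! ### The Leray projection and the nonlinear symbol. -/

/-- Vectors of `ℂ³` with the Euclidean norm. -/
abbrev Vec : Type := EuclideanSpace ℂ (Fin 3)

/-- The linear form `a ↦ (k, a)`. -/
def dotK (k : Fin 3 → ℤ) : Vec →L[ℂ] ℂ := innerSL ℂ (waveVec k)

lemma dotK_apply (k : Fin 3 → ℤ) (a : Vec) : dotK k a = ∑ j, (k j : ℂ) * a j := by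
  simp [dotK, PiLp.inner_apply, mul_comm]

lemma norm_dotK_le (k : Fin 3 → ℤ) (a : Vec) : ‖dotK k a‖ ≤ eLen k * ‖a‖ := by
  rw [← norm_waveVec]; exact norm_inner_le_norm (𝕜 := ℂ) (waveVec k) a

lemma dotK_waveVec (k : Fin 3 → ℤ) : dotK k (waveVec k) = (eLen k : ℂ) ^ 2 := by
  rw [dotK, innerSL_apply_apply, inner_self_eq_norm_sq_to_K, norm_waveVec]
  rfl

/-- The Leray projection onto the vectors orthogonal to `k`. -/
def leray (k : Fin 3 → ℤ) : Vec →L[ℂ] Vec :=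
  ContinuousLinearMap.id ℂ Vec - ((eLen k : ℂ) ^ 2)⁻¹ • (dotK k).smulRight (waveVec k)

lemma leray_apply (k : Fin 3 → ℤ) (a : Vec) :
    leray k a = a - (((eLen k : ℂ) ^ 2)⁻¹ * dotK k a) • waveVec k := by
  simp [leray, smul_smul]

lemma norm_leray_le (k : Fin 3 → ℤ) (a : Vec) : ‖leray k a‖ ≤ 2 * ‖a‖ := by
  rw [leray_apply]
  refine (norm_sub_le _ _).trans ?_
  rw [norm_smul, norm_mul, norm_waveVec, norm_inv, norm_pow, Complex.norm_real,
    Real.norm_of_nonneg (eLen_nonneg k)]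
  rcases eq_or_ne k 0 with rfl | hk
  · simp only [eLen_zero, mul_zero, add_zero]; linarith [norm_nonneg a]
  · have h1 := one_le_eLen hk
    have h2 : (eLen k ^ 2)⁻¹ * ‖dotK k a‖ * eLen k ≤ (eLen k ^ 2)⁻¹ * (eLen k * ‖a‖) * eLen k := by
      gcongr
      exact norm_dotK_le k a
    have h3 : (eLen k ^ 2)⁻¹ * (eLen k * ‖a‖) * eLen k = ‖a‖ := by field_simp
    linarith

lemma dotK_leray (k : Fin 3 → ℤ) (a : Vec) : dotK k (leray k a) = 0 := by
  rcases eq_or_ne k 0 with rfl | hk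
  · simp [dotK_apply]
  · have h1 : (eLen k : ℂ) ≠ 0 := by
      have := one_le_eLen hk
      exact_mod_cast (by linarith : (0 : ℝ) < eLen k).ne'
    rw [leray_apply, map_sub, map_smul, dotK_waveVec, smul_eq_mul]
    field_simp
    ring

/-- The symbol `(a, b) ↦ i (k, a) P_k b` of the projected nonlinearity. -/
def nlin (k : Fin 3 → ℤ) : Vec →L[ℂ] Vec →L[ℂ] Vec :=
  Complex.I • (ContinuousLinearMap.lsmul ℂ ℂ).bilinearComp (dotK k) (leray k)

lemma nlin_apply (k : Fin 3 → ℤ) (a b : Vec) :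
    nlin k a b = Complex.I • dotK k a • leray k b := by
  simp [nlin]

lemma norm_nlin_le (k : Fin 3 → ℤ) (a b : Vec) : ‖nlin k a b‖ ≤ 2 * eLen k * ‖a‖ * ‖b‖ := by
  rw [nlin_apply, norm_smul, norm_smul, Complex.norm_I, one_mul]
  calc _ ≤ (eLen k * ‖a‖) * (2 * ‖b‖) :=
        mul_le_mul (norm_dotK_le k a) (norm_leray_le k b) (norm_nonneg _)
          (mul_nonneg (eLen_nonneg k) (norm_nonneg _))
    _ = _ := by ring

/-! ### Bilinear convolutions of majorized coefficients. -/

section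

variable {F : Type*} [NormedAddCommGroup F] [NormedSpace ℂ F] {ν : ℝ}

/-- The `k`-th coefficient of a bilinear expression in a field with coefficients `u`. -/
def bconv (β : Vec →L[ℂ] Vec →L[ℂ] F) (u : (Fin 3 → ℤ) → ℂ → Vec) (k : Fin 3 → ℤ) (t : ℂ) : F :=
  ∑' l, β (u l t) (u (k - l) t)

/-- The coefficients `u` are holomorphic in the sector and majorized by `A`. -/
def Majorized (ν : ℝ) (u : (Fin 3 → ℤ) → ℂ → Vec) (A : (Fin 3 → ℤ) → ℝ) : Prop :=
  ∀ k, DecayBound ν k (A k) (u k)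

variable {u u' : (Fin 3 → ℤ) → ℂ → Vec} {A A' : (Fin 3 → ℤ) → ℝ}
  {β : Vec →L[ℂ] Vec →L[ℂ] F} {C : ℝ} {k : Fin 3 → ℤ} {t : ℂ}

lemma Majorized.norm_bilin_le (hν : 0 < ν) (hu : Majorized ν u A) (hC : 0 ≤ C)
    (hβ : ∀ a b, ‖β a b‖ ≤ C * ‖a‖ * ‖b‖) (ht : t ∈ sector) (k l : Fin 3 → ℤ) :
    ‖β (u l t) (u (k - l) t)‖ ≤ C * (A l * A (k - l)) * decay ν k t := by
  have h1 := (hu l).bound t ht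
  have h2 := (hu (k - l)).bound t ht
  have h3 := (hu l).nonneg
  have h4 := (hu (k - l)).nonneg
  have h5 := decay_pos ν l t
  have h6 := decay_pos ν (k - l) t
  calc _ ≤ C * ‖u l t‖ * ‖u (k - l) t‖ := hβ _ _
    _ ≤ C * (A l * decay ν l t) * (A (k - l) * decay ν (k - l) t) := by gcongr
    _ = C * (A l * A (k - l)) * (decay ν l t * decay ν (k - l) t) := by ring
    _ ≤ _ := by gcongr; exact decay_mul_le hν k l ht

lemma Majorized.summable_bilin (hν : 0 < ν) (hu : Majorized ν u A) (hA : IsH1Seq A) (hC : 0 ≤ C)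
    (hβ : ∀ a b, ‖β a b‖ ≤ C * ‖a‖ * ‖b‖) (ht : t ∈ sector) (k : Fin 3 → ℤ) :
    Summable fun l => ‖β (u l t) (u (k - l) t)‖ :=
  Summable.of_nonneg_of_le (fun _ => norm_nonneg _) (hu.norm_bilin_le hν hC hβ ht k)
    (((hA.summable_mul hA k).mul_left C).mul_right _)

lemma Majorized.bconv [CompleteSpace F] (hν : 0 < ν) (hu : Majorized ν u A) (hA : IsH1Seq A)
    (hC : 0 ≤ C) (hβ : ∀ a b, ‖β a b‖ ≤ C * ‖a‖ * ‖b‖) (k : Fin 3 → ℤ) :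
    DecayBound ν k (C * conv A A k) (bconv β u k) := by
  constructor
  · refine Complex.differentiableOn_tsum_of_summable_norm ((hA.summable_mul hA k).mul_left C)
      (fun l => ?_) isOpen_sector (fun l t ht => ?_)
    · exact fun t ht => ((β.differentiableAt.comp_differentiableWithinAt t ((hu l).holo t ht)).clm_apply
        ((hu (k - l)).holo t ht))
    · refine (hu.norm_bilin_le hν hC hβ ht k l).trans ?_
      refine mul_le_of_le_one_right ?_ (decay_le_one hν k ht)
      exact mul_nonneg hC (mul_nonneg (hA.nonneg _) (hA.nonneg _))
  · intro t ht
    have h := hu.summable_bilin hν hA hC hβ ht k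
    refine (norm_tsum_le_tsum_norm h).trans ?_
    rw [NSTorus.conv, ← tsum_mul_left, ← tsum_mul_right]
    exact h.tsum_le_tsum (hu.norm_bilin_le hν hC hβ ht k)
      (((hA.summable_mul hA k).mul_left C).mul_right _)

/-- The splitting `β(a', b') - β(a, b) = β(a' - a, b') + β(a, b' - b)` is mirrored exactly by the
majorants, so the bound is a difference of two scalar convolutions and can telescope. -/
lemma Majorized.norm_bconv_sub_le [CompleteSpace F] (hν : 0 < ν) (hu : Majorized ν u A)
    (hu' : Majorized ν u' A') (hA : IsH1Seq A) (hA' : IsH1Seq A') (hC : 0 ≤ C)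
    (hβ : ∀ a b, ‖β a b‖ ≤ C * ‖a‖ * ‖b‖) (ht : t ∈ sector)
    (hd : ∀ k, ‖u' k t - u k t‖ ≤ (A' k - A k) * decay ν k t) (k : Fin 3 → ℤ) :
    ‖NSTorus.bconv β u' k t - NSTorus.bconv β u k t‖ ≤
      C * (conv A' A' k - conv A A k) * decay ν k t := by
  have h := (hu.summable_bilin hν hA hC hβ ht k).of_norm
  have h' := (hu'.summable_bilin hν hA' hC hβ ht k).of_norm
  have hs : Summable fun l => C * (A' l * A' (k - l) - A l * A (k - l)) * decay ν k t :=
    (((hA'.summable_mul hA' k).sub (hA.summable_mul hA k)).mul_left C).mul_right _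
  rw [NSTorus.bconv, NSTorus.bconv, ← h'.tsum_sub h, NSTorus.conv, NSTorus.conv,
    ← (hA'.summable_mul hA' k).tsum_sub (hA.summable_mul hA k), ← tsum_mul_left, ← tsum_mul_right]
  refine tsum_of_norm_bounded hs.hasSum fun l => ?_
  have e : β (u' l t) (u' (k - l) t) - β (u l t) (u (k - l) t) =
      β (u' l t - u l t) (u' (k - l) t) + β (u l t) (u' (k - l) t - u (k - l) t) := by
    simp
  have hAd : ∀ l, 0 ≤ A' l - A l := fun l =>
    nonneg_of_mul_nonneg_left ((norm_nonneg _).trans (hd l)) (decay_pos _ _ _)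
  have h1 := hd l
  have h2 := hd (k - l)
  have h3 := (hu l).bound t ht
  have h4 := (hu' (k - l)).bound t ht
  have h5 := decay_pos ν l t
  have h6 := decay_pos ν (k - l) t
  have h7 := (hu l).nonneg
  have h8 := (hu' (k - l)).nonneg
  have h9 := hAd l
  have h10 := hAd (k - l)
  rw [e]
  refine (norm_add_le _ _).trans ?_
  calc _ ≤ C * ‖u' l t - u l t‖ * ‖u' (k - l) t‖ + C * ‖u l t‖ * ‖u' (k - l) t - u (k - l) t‖ :=
        add_le_add (hβ _ _) (hβ _ _)
    _ ≤ C * ((A' l - A l) * decay ν l t) * (A' (k - l) * decay ν (k - l) t) +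
          C * (A l * decay ν l t) * ((A' (k - l) - A (k - l)) * decay ν (k - l) t) := by gcongr
    _ = C * ((A' l - A l) * A' (k - l) + A l * (A' (k - l) - A (k - l))) *
          (decay ν l t * decay ν (k - l) t) := by ring
    _ ≤ C * ((A' l - A l) * A' (k - l) + A l * (A' (k - l) - A (k - l))) * decay ν k t := by
        gcongr
        exact decay_mul_le hν k l ht
    _ = _ := by ring

end

/-! ### Picard iteration and its limit. -/

/-- One step of the Picard iteration for the Navier-Stokes equations in Fourier variables. -/
def picardStep (ν : ℝ) (vh : (Fin 3 → ℤ) → Vec) (u : (Fin 3 → ℤ) → ℂ → Vec) (k : Fin 3 → ℤ)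
    (t : ℂ) : Vec :=
  Complex.exp (-((ν * eLen k ^ 2 : ℝ) * t)) • vh k -
    duhamel (ν * eLen k ^ 2) (bconv (nlin k) u k) t

/-- The Picard iterates, starting from `0`. -/
def picardSeq (ν : ℝ) (vh : (Fin 3 → ℤ) → Vec) : ℕ → (Fin 3 → ℤ) → ℂ → Vec
  | 0 => 0
  | n + 1 => picardStep ν vh (picardSeq ν vh n)

section

variable {ν : ℝ} {vh : (Fin 3 → ℤ) → Vec} {u u' : (Fin 3 → ℤ) → ℂ → Vec}
  {a A A' : (Fin 3 → ℤ) → ℝ} {k : Fin 3 → ℤ} {t : ℂ}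

lemma bconv_nlin_zero (u : (Fin 3 → ℤ) → ℂ → Vec) : bconv (nlin 0) u 0 = 0 := by
  ext1 t
  simp [bconv, nlin_apply, dotK_apply]

lemma duhamel_zero {F : Type*} [NormedAddCommGroup F] [NormedSpace ℂ F] (lam : ℝ) (t : ℂ) :
    duhamel lam (0 : ℂ → F) t = 0 := by
  simp [duhamel]

lemma two_eLen_nonneg (k : Fin 3 → ℤ) : 0 ≤ 2 * eLen k := by linarith [eLen_nonneg k]

lemma lam_nonneg (hν : 0 < ν) (k : Fin 3 → ℤ) : 0 ≤ ν * eLen k ^ 2 := by positivity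

lemma Majorized.nlin (hν : 0 < ν) (hu : Majorized ν u A) (hA : IsH1Seq A) (k : Fin 3 → ℤ) :
    DecayBound ν k (2 * eLen k * conv A A k) (NSTorus.bconv (nlin k) u k) :=
  hu.bconv hν hA (two_eLen_nonneg k) (norm_nlin_le k) k

lemma hasDerivAt_picardStep (hν : 0 < ν) (hu : Majorized ν u A) (hA : IsH1Seq A)
    (k : Fin 3 → ℤ) (ht : t ∈ sector) :
    HasDerivAt (picardStep ν vh u k)
      (-((ν * eLen k ^ 2 : ℝ) : ℂ) • picardStep ν vh u k t - bconv (nlin k) u k t) t := by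
  have h1 := hasDerivAt_duhamel hν (lam_nonneg hν k) (hu.nlin hν hA k) ht
  have h2 : HasDerivAt (fun z : ℂ => -(((ν * eLen k ^ 2 : ℝ) : ℂ) * z))
      (-((ν * eLen k ^ 2 : ℝ) : ℂ)) t := by
    simpa only [id, mul_one] using ((hasDerivAt_id t).const_mul ((ν * eLen k ^ 2 : ℝ) : ℂ)).fun_neg
  have h3 := (h2.cexp.smul_const (vh k)).fun_sub h1
  change HasDerivAt (fun t => Complex.exp (-((ν * eLen k ^ 2 : ℝ) * t)) • vh k -
    duhamel (ν * eLen k ^ 2) (bconv (nlin k) u k) t) _ t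
  convert! h3 using 1
  rw [picardStep, smul_sub, smul_smul, mul_comm (Complex.exp _)]
  abel

/-- The constant is `2|k| · 4/(ν|k|²) = 8/(ν|k|)`: symbol times Duhamel gain. -/
lemma Majorized.picardStep (hν : 0 < ν) (hu : Majorized ν u A) (hA : IsH1Seq A)
    (hvh : ∀ k, ‖vh k‖ ≤ a k) :
    Majorized ν (picardStep ν vh u) (fun k => a k + 8 / ν / eLen k * conv A A k) := by
  intro k
  refine ⟨fun t ht => (hasDerivAt_picardStep hν hu hA k ht).differentiableAt.differentiableWithinAt,
    fun t ht => ?_⟩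
  have hτ := re_pos_of_mem_sector ht
  have h1 : ‖Complex.exp (-((ν * eLen k ^ 2 : ℝ) * t)) • vh k‖ ≤ a k * decay ν k t := by
    rw [norm_smul, Complex.norm_exp, mul_comm]
    refine mul_le_mul (hvh k) ?_ (Real.exp_pos _).le ((norm_nonneg _).trans (hvh k))
    rw [decay, Real.exp_le_exp, Complex.neg_re, Complex.re_ofReal_mul]
    have h0 : eLen k / 2 ≤ eLen k ^ 2 := by linarith [eLen_le_sq k, eLen_nonneg k]
    have := mul_le_mul_of_nonneg_left h0 (mul_pos hν hτ).le
    linarith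
  rw [NSTorus.picardStep, add_mul]
  refine (norm_sub_le _ _).trans (add_le_add h1 ?_)
  -- The nonlinear term has no zero mode, which matches the value `0` of `8 / ν / eLen 0`.
  rcases eq_or_ne k 0 with rfl | hk
  · rw [bconv_nlin_zero, duhamel_zero]; simp
  · refine (norm_duhamel_le hν hk (hu.nlin hν hA k).bound ht).trans (le_of_eq ?_)
    have := one_le_eLen hk
    field_simp
    ring

lemma Majorized.norm_picardStep_sub_le (hν : 0 < ν) (hu : Majorized ν u A)
    (hu' : Majorized ν u' A') (hA : IsH1Seq A) (hA' : IsH1Seq A')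
    (hd : ∀ t ∈ sector, ∀ k, ‖u' k t - u k t‖ ≤ (A' k - A k) * decay ν k t) (ht : t ∈ sector)
    (k : Fin 3 → ℤ) :
    ‖NSTorus.picardStep ν vh u' k t - NSTorus.picardStep ν vh u k t‖ ≤
      8 / ν / eLen k * (conv A' A' k - conv A A k) * decay ν k t := by
  rw [NSTorus.picardStep, NSTorus.picardStep, sub_sub_sub_cancel_left,
    duhamel_sub hν (lam_nonneg hν k) (hu.nlin hν hA k) (hu'.nlin hν hA' k) ht]
  rcases eq_or_ne k 0 with rfl | hk
  · rw [bconv_nlin_zero, bconv_nlin_zero]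
    have : duhamel (ν * eLen 0 ^ 2) (fun s => (0 : ℂ → Vec) s - (0 : ℂ → Vec) s) t = 0 := by
      simp [duhamel]
    rw [this]; simp
  · refine (norm_duhamel_le hν hk
      (M := 2 * eLen k * (conv A' A' k - conv A A k)) (fun s hs => ?_) ht).trans (le_of_eq ?_)
    · rw [norm_sub_rev]
      exact hu.norm_bconv_sub_le hν hu' hA hA' (two_eLen_nonneg k) (norm_nlin_le k) hs (hd s hs) k
    · have := one_le_eLen hk
      field_simp
      ring

lemma majorized_zero (ν : ℝ) : Majorized ν 0 0 := fun k =>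
  ⟨differentiableOn_const 0, fun t _ => by simp⟩

lemma majorized_picardSeq (hν : 0 < ν) (ha : IsH1Seq a) (hvh : ∀ k, ‖vh k‖ ≤ a k)
    (hs : 16 * (8 / ν) ^ 2 * latticeSum * energy a ≤ 1)
    (n : ℕ) :
    Majorized ν (picardSeq ν vh n) (majorantSeq (8 / ν) a n) := by
  induction n with
  | zero => exact majorized_zero ν
  | succ n ih =>
    exact ih.picardStep hν (isH1Seq_majorantSeq (by positivity) ha hs n).1 hvh

/-- Domination by the scalar increments takes the place of a contraction estimate. -/
lemma norm_picardSeq_succ_sub_le (hν : 0 < ν) (ha : IsH1Seq a) (hvh : ∀ k, ‖vh k‖ ≤ a k)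
    (hs : 16 * (8 / ν) ^ 2 * latticeSum * energy a ≤ 1)
    (n : ℕ) : ∀ t ∈ sector, ∀ k,
    ‖picardSeq ν vh (n + 1) k t - picardSeq ν vh n k t‖ ≤
      (majorantSeq (8 / ν) a (n + 1) k - majorantSeq (8 / ν) a n k) * decay ν k t := by
  have hA := fun n => (isH1Seq_majorantSeq (c := 8 / ν) (by positivity) ha hs n).1
  have hm := majorized_picardSeq hν ha hvh hs
  induction n with
  | zero =>
    intro t ht k
    simpa [picardSeq, majorantSeq] using (hm 1 k).bound t ht
  | succ n ih =>
    intro t ht k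
    refine ((hm n).norm_picardStep_sub_le hν (hm (n + 1)) (hA n) (hA (n + 1)) ih ht k).trans
      (le_of_eq ?_)
    simp only [majorantSeq]
    ring

lemma norm_picardSeq_sub_le (hν : 0 < ν) (ha : IsH1Seq a) (hvh : ∀ k, ‖vh k‖ ≤ a k)
    (hs : 16 * (8 / ν) ^ 2 * latticeSum * energy a ≤ 1)
    {m n : ℕ} (hmn : m ≤ n) (ht : t ∈ sector) (k : Fin 3 → ℤ) :
    ‖picardSeq ν vh n k t - picardSeq ν vh m k t‖ ≤
      (majorantSeq (8 / ν) a n k - majorantSeq (8 / ν) a m k) * decay ν k t := by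
  induction n, hmn using Nat.le_induction with
  | base => simp
  | succ n _ ih =>
    have h := norm_picardSeq_succ_sub_le hν ha hvh hs n t ht k
    calc _ ≤ ‖picardSeq ν vh (n + 1) k t - picardSeq ν vh n k t‖ +
          ‖picardSeq ν vh n k t - picardSeq ν vh m k t‖ := norm_sub_le_norm_sub_add_norm_sub _ _ _
      _ ≤ _ := add_le_add h ih
      _ = _ := by ring

/-- For small data the Picard iterates converge to a solution of the integral equations. -/
lemma exists_picard_limit (hν : 0 < ν) (ha : IsH1Seq a) (hvh : ∀ k, ‖vh k‖ ≤ a k)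
    (hs : 16 * (8 / ν) ^ 2 * latticeSum * energy a ≤ 1) : ∃ (V : (Fin 3 → ℤ) → ℝ) (u : (Fin 3 → ℤ) → ℂ → Vec),
    IsH1Seq V ∧ Majorized ν u V ∧ (∀ k, ∀ t ∈ sector, u k t = picardStep ν vh u k t) ∧
    ∀ k, ∀ t ∈ sector, Tendsto (fun n => picardSeq ν vh n k t) atTop (𝓝 (u k t)) := by
  have hc : 0 ≤ 8 / ν := by positivity
  have hA := fun n => (isH1Seq_majorantSeq (c := 8 / ν) hc ha hs n).1
  have hm := majorized_picardSeq hν ha hvh hs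
  obtain ⟨V, hV, hWV, hWlim, hconv⟩ := exists_majorant hc ha hs
  have hcau : ∀ k, ∀ t ∈ sector, CauchySeq fun n => picardSeq ν vh n k t := by
    intro k t ht
    have hz : Tendsto (fun n => 2 * ((V k - majorantSeq (8 / ν) a n k) * decay ν k t)) atTop
        (𝓝 0) := by
      have := (((hWlim k).const_sub (V k)).mul_const (decay ν k t)).const_mul 2
      simpa using this
    refine cauchySeq_of_le_tendsto_0 _ (fun n m N hn hm => ?_) hz
    have key : ∀ n, N ≤ n → dist (picardSeq ν vh n k t) (picardSeq ν vh N k t) ≤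
        (V k - majorantSeq (8 / ν) a N k) * decay ν k t := by
      intro n hn
      rw [dist_eq_norm]
      refine (norm_picardSeq_sub_le hν ha hvh hs hn ht k).trans ?_
      have := (decay_pos ν k t).le
      gcongr
      exact hWV n k
    refine (dist_triangle_right _ _ (picardSeq ν vh N k t)).trans ?_
    linarith [key n hn, key m hm]
  have hex : ∀ k t, ∃ w : Vec, t ∈ sector →
      Tendsto (fun n => picardSeq ν vh n k t) atTop (𝓝 w) := by
    intro k t
    by_cases ht : t ∈ sector
    · obtain ⟨w, hw⟩ := cauchySeq_tendsto_of_complete (hcau k t ht)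
      exact ⟨w, fun _ => hw⟩
    · exact ⟨0, fun h => absurd h ht⟩
  choose u hu using hex
  have hlim : ∀ k, ∀ t ∈ sector, Tendsto (fun n => picardSeq ν vh n k t) atTop (𝓝 (u k t)) :=
    fun k t ht => hu k t ht
  -- The tail bound is uniform in `t`. It gives holomorphy of the limit, its majorant (at `n = 0`)
  -- and the passage to the limit in the equation.
  have hdist : ∀ n, ∀ t ∈ sector, ∀ k, ‖u k t - picardSeq ν vh n k t‖ ≤
      (V k - majorantSeq (8 / ν) a n k) * decay ν k t := by
    intro n t ht k
    refine le_of_tendsto ((hlim k t ht).sub_const _).norm ?_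
    filter_upwards [eventually_ge_atTop n] with m hnm
    refine (norm_picardSeq_sub_le hν ha hvh hs hnm ht k).trans ?_
    have := (decay_pos ν k t).le
    gcongr
    exact hWV m k
  have hmaj : Majorized ν u V := by
    intro k
    constructor
    · have hunif : TendstoUniformlyOn (fun n => picardSeq ν vh n k) (u k) atTop sector := by
        rw [Metric.tendstoUniformlyOn_iff]
        intro ε hε
        have hz : Tendsto (fun n => V k - majorantSeq (8 / ν) a n k) atTop (𝓝 0) := by
          simpa using (hWlim k).const_sub (V k)
        filter_upwards [hz.eventually_lt_const hε] with n hn t ht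
        rw [dist_eq_norm]
        refine ((hdist n t ht k).trans ?_).trans_lt hn
        exact mul_le_of_le_one_right (sub_nonneg.2 (hWV n k)) (decay_le_one hν k ht)
      exact hunif.tendstoLocallyUniformlyOn.differentiableOn
        (Eventually.of_forall fun n => (hm n k).holo) isOpen_sector
    · intro t ht
      have h := hdist 0 t ht k
      simpa [picardSeq, majorantSeq] using h
  refine ⟨V, u, hV, hmaj, fun k t ht => ?_, hlim⟩
  refine tendsto_nhds_unique ((tendsto_add_atTop_iff_nat 1).2 (hlim k t ht)) ?_
  rw [tendsto_iff_norm_sub_tendsto_zero]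
  have hz : Tendsto (fun n => 8 / ν / eLen k * (conv V V k -
      conv (majorantSeq (8 / ν) a n) (majorantSeq (8 / ν) a n) k) * decay ν k t) atTop (𝓝 0) := by
    simpa using (((hconv k).const_sub (conv V V k)).const_mul (8 / ν / eLen k)).mul_const
      (decay ν k t)
  refine squeeze_zero (fun _ => norm_nonneg _) (fun n => ?_) hz
  rw [norm_sub_rev]
  exact (hm n).norm_picardStep_sub_le hν hmaj (hA n) hV (hdist n) ht k

end

/-! ### Properties of the limit: differential equation, initial value, incompressibility, reality.
-/

section

variable {ν : ℝ} {vh : (Fin 3 → ℤ) → Vec} {u : (Fin 3 → ℤ) → ℂ → Vec}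
  {V : (Fin 3 → ℤ) → ℝ} {k : Fin 3 → ℤ} {t : ℂ}

lemma hasDerivAt_of_eq_picardStep (hν : 0 < ν) (hu : Majorized ν u V) (hV : IsH1Seq V)
    (hfix : ∀ k, ∀ t ∈ sector, u k t = picardStep ν vh u k t) (k : Fin 3 → ℤ)
    (ht : t ∈ sector) :
    HasDerivAt (u k) (-((ν * eLen k ^ 2 : ℝ) : ℂ) • u k t - bconv (nlin k) u k t) t := by
  have h := hasDerivAt_picardStep (vh := vh) hν hu hV k ht
  rw [← hfix k t ht] at h
  refine h.congr_of_eventuallyEq ?_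
  filter_upwards [isOpen_sector.mem_nhds ht] with z hz using hfix k z hz

lemma tendsto_of_eq_picardStep (hν : 0 < ν) (hu : Majorized ν u V) (hV : IsH1Seq V)
    (hfix : ∀ k, ∀ t ∈ sector, u k t = picardStep ν vh u k t) (k : Fin 3 → ℤ) :
    Tendsto (u k) (𝓝[sector] 0) (𝓝 (vh k)) := by
  have h1 : Tendsto (fun t : ℂ => Complex.exp (-((ν * eLen k ^ 2 : ℝ) * t)) • vh k)
      (𝓝[sector] 0) (𝓝 (vh k)) := by
    have hc : Continuous fun t : ℂ => Complex.exp (-((ν * eLen k ^ 2 : ℝ) * t)) • vh k := by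
      fun_prop
    simpa using (hc.tendsto 0).mono_left nhdsWithin_le_nhds
  have h2 : Tendsto (fun t => duhamel (ν * eLen k ^ 2) (bconv (nlin k) u k) t)
      (𝓝[sector] 0) (𝓝 0) := by
    have h3 : Tendsto (fun t : ℂ => ‖t‖ * (2 * eLen k * conv V V k)) (𝓝[sector] 0) (𝓝 0) := by
      have hc : Continuous fun t : ℂ => ‖t‖ * (2 * eLen k * conv V V k) := by fun_prop
      simpa using (hc.tendsto 0).mono_left nhdsWithin_le_nhds
    refine squeeze_zero_norm' ?_ h3
    filter_upwards [self_mem_nhdsWithin] with t ht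
    exact norm_duhamel_le_const hν (lam_nonneg hν k) (hu.nlin hν hV k) ht
  have h4 := h1.sub h2
  rw [sub_zero] at h4
  refine h4.congr' ?_
  filter_upwards [self_mem_nhdsWithin] with t ht
  exact (hfix k t ht).symm

lemma dotK_bconv_nlin (hν : 0 < ν) (hu : Majorized ν u V) (hV : IsH1Seq V) (k : Fin 3 → ℤ)
    (ht : t ∈ sector) : dotK k (bconv (nlin k) u k t) = 0 := by
  rw [bconv, ContinuousLinearMap.map_tsum _
    (hu.summable_bilin hν hV (two_eLen_nonneg k) (norm_nlin_le k) ht k).of_norm]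
  simp [nlin_apply, dotK_leray]

/-- Pairing the integral equation with `k` removes the data by `hdiv` and the Duhamel term by the
projection. -/
lemma dotK_eq_zero_of_eq_picardStep (hν : 0 < ν) (hu : Majorized ν u V) (hV : IsH1Seq V)
    (hfix : ∀ k, ∀ t ∈ sector, u k t = picardStep ν vh u k t) (hdiv : ∀ k, dotK k (vh k) = 0)
    (k : Fin 3 → ℤ) (ht : t ∈ sector) : dotK k (u k t) = 0 := by
  rw [hfix k t ht, picardStep, map_sub, map_smul, hdiv, smul_zero, zero_sub, neg_eq_zero, duhamel,
    ← ContinuousLinearMap.intervalIntegral_comp_comm _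
      (intervalIntegrable_duhamel hν (lam_nonneg hν k) (hu.nlin hν hV k) ht)]
  rw [intervalIntegral.integral_congr_ae (g := fun _ => 0)]
  · simp
  · refine Eventually.of_forall fun s hs => ?_
    rw [Set.uIoc_of_le zero_le_one] at hs
    rw [map_smul, map_smul, dotK_bconv_nlin hν hu hV k (smul_mem_sector ht hs.1)]
    simp

/-- Coordinatewise complex conjugation on `ℂ³`. -/
def conjV : Vec →L[ℝ] Vec :=
  LinearMap.toContinuousLinearMap
    { toFun := fun a => WithLp.toLp 2 fun j => starRingEnd ℂ (a j)
      map_add' := fun a b => by ext j; simp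
      map_smul' := fun r a => by ext j; simp }

/-- Coordinatewise complex conjugation on `ℂ³` as an equivalence. -/
def conjVEquiv : Vec ≃L[ℝ] Vec :=
  ContinuousLinearEquiv.equivOfInverse conjV conjV
    (fun a => by ext j; simp [conjV]) (fun a => by ext j; simp [conjV])

@[simp] lemma conjV_apply (a : Vec) (j : Fin 3) : conjV a j = starRingEnd ℂ (a j) := rfl

lemma conjV_smul (c : ℂ) (a : Vec) : conjV (c • a) = starRingEnd ℂ c • conjV a := by
  ext j; simp

lemma dotK_neg_conjV (k : Fin 3 → ℤ) (a : Vec) :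
    dotK (-k) (conjV a) = -starRingEnd ℂ (dotK k a) := by
  simp [dotK_apply, map_sum]

/-- The sign from `k ↦ -k` cancels the sign from conjugating `i`. -/
lemma nlin_neg_conjV (k : Fin 3 → ℤ) (a b : Vec) :
    nlin (-k) (conjV a) (conjV b) = conjV (nlin k a b) := by
  have hw : waveVec (-k) = -conjV (waveVec k) := by ext j; simp
  rw [nlin_apply, nlin_apply, leray_apply, leray_apply, dotK_neg_conjV, dotK_neg_conjV, conjV_smul,
    conjV_smul, map_sub, conjV_smul, hw, eLen_neg]
  simp only [map_mul, map_inv₀, map_pow, Complex.conj_ofReal, Complex.conj_I, smul_neg, neg_smul,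
    mul_neg, neg_neg]

lemma conjV_picardSeq (hvh : ∀ k, vh (-k) = conjV (vh k)) (n : ℕ) (k : Fin 3 → ℤ) (t : ℝ) :
    picardSeq ν vh n (-k) t = conjV (picardSeq ν vh n k t) := by
  induction n generalizing k t with
  | zero => simp [picardSeq]
  | succ n ih =>
    have hb : ∀ t : ℝ, bconv (nlin (-k)) (picardSeq ν vh n) (-k) t =
        conjV (bconv (nlin k) (picardSeq ν vh n) k t) := by
      intro t
      -- As an equivalence, conjugation commutes with sums and integrals without any convergence
      -- hypothesis.
      have hsum : ∀ f : (Fin 3 → ℤ) → Vec, conjV (∑' l, f l) = ∑' l, conjV (f l) := fun f =>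
        conjVEquiv.map_tsum
      rw [bconv, bconv, hsum, ← (Equiv.neg (Fin 3 → ℤ)).tsum_eq]
      refine tsum_congr fun l => ?_
      rw [Equiv.neg_apply, show -k - -l = -(k - l) by abel, ih, ih, nlin_neg_conjV]
    simp only [picardSeq, picardStep, map_sub]
    rw [hvh, eLen_neg, conjV_smul]
    congr 1
    · rw [← Complex.exp_conj]
      simp
    · rw [duhamel, duhamel]
      have hI : ∀ f : ℝ → Vec, conjV (∫ s in (0 : ℝ)..1, f s) = ∫ s in (0 : ℝ)..1, conjV (f s) := by
        intro f
        simp only [intervalIntegral.integral_of_le zero_le_one]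
        exact (conjVEquiv.integral_comp_comm f).symm
      rw [hI]
      refine intervalIntegral.integral_congr fun s _ => ?_
      have := hb (s * t)
      push_cast at this
      rw [this, conjV_smul, conjV_smul, ← Complex.exp_conj]
      simp

end

/-! ### Fourier series on `Q(∞)` and termwise differentiation. -/

/-- A locally normally convergent series of holomorphic functions of several variables may be
differentiated term by term. -/
lemma hasFDerivAt_tsum_of_holomorphic {ι E F : Type*} [NormedAddCommGroup E] [NormedSpace ℂ E]
    [NormedAddCommGroup F] [NormedSpace ℂ F] [CompleteSpace F] {f : ι → E → F} {b : ι → ℝ}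
    (hb : Summable b) {U : Set E} (hU : IsOpen U) (hf : ∀ i, DifferentiableOn ℂ (f i) U)
    (hfb : ∀ i, ∀ x ∈ U, ‖f i x‖ ≤ b i) {x : E} (hx : x ∈ U) :
    Summable (fun i => fderiv ℂ (f i) x) ∧
      HasFDerivAt (fun y => ∑' i, f i y) (∑' i, fderiv ℂ (f i) x) x := by
  obtain ⟨r, hr, hball⟩ := Metric.isOpen_iff.1 hU x hx
  have hsub : ∀ y ∈ Metric.ball x (r / 2), Metric.ball y (r / 2) ⊆ U := by
    intro y hy z hz
    refine hball ?_
    rw [Metric.mem_ball] at *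
    linarith [dist_triangle z y x]
  have hbound : ∀ i, ∀ y ∈ Metric.ball x (r / 2), ‖fderiv ℂ (f i) y‖ ≤ 2 * b i / (r / 2) := by
    intro i y hy
    refine Complex.norm_fderiv_le_div_of_mapsTo_ball ((hf i).mono (hsub y hy)) (fun z hz => ?_)
      (by positivity)
    rw [Metric.mem_closedBall, dist_eq_norm]
    refine (norm_sub_le _ _).trans ?_
    linarith [hfb i z (hsub y hy hz), hfb i y (hsub y hy (Metric.mem_ball_self (by positivity)))]
  have hb' : Summable fun i => 2 * b i / (r / 2) := (hb.mul_left 2).div_const _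
  have hxm : x ∈ Metric.ball x (r / 2) := Metric.mem_ball_self (by positivity)
  refine ⟨Summable.of_norm_bounded hb' fun i => hbound i x hxm, ?_⟩
  let : NormedSpace ℝ E := NormedSpace.restrictScalars ℝ ℂ E
  refine hasFDerivAt_tsum_of_isPreconnected hb' Metric.isOpen_ball
    (convex_ball x (r / 2)).isPreconnected (fun i y hy => ?_) hbound hxm
    (Summable.of_norm_bounded hb fun i => hfb i x hx) hxm
  exact ((hf i).differentiableAt
    (hU.mem_nhds (hsub y hy (Metric.mem_ball_self (by positivity))))).hasFDerivAt

section

variable {ν α : ℝ}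

lemma isOpen_Q (ν α : ℝ) : IsOpen (Q ν α) := by
  have : Q ν α = {q : ℂ × (Fin 3 → ℂ) | q.1 ∈ sector} ∩
      ⋂ j, {q : ℂ × (Fin 3 → ℂ) | 4 / (ν * α) * |(q.2 j).im| < q.1.re} := by
    ext q; simp [Q]
  rw [this]
  refine (isOpen_sector.preimage continuous_fst).inter (isOpen_iInter_of_finite fun j => ?_)
  refine isOpen_lt ?_ (Complex.continuous_re.comp continuous_fst)
  exact continuous_const.mul (continuous_abs.comp (Complex.continuous_im.comp
    ((continuous_apply j).comp continuous_snd)))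

lemma toC_mem_Q {t : ℂ} (ht : t ∈ sector) (x : Fin 3 → ℝ) : (t, toC x) ∈ Q ν α :=
  ⟨ht, fun j => by simpa [toC] using re_pos_of_mem_sector ht⟩

lemma norm_expI (k : Fin 3 → ℤ) (x : Fin 3 → ℂ) :
    ‖expI k x‖ = Real.exp (-∑ j, (k j : ℝ) * (x j).im) := by
  rw [expI, Complex.norm_exp]
  simp

lemma norm_expI_toC (k : Fin 3 → ℤ) (x : Fin 3 → ℝ) : ‖expI k (toC x)‖ = 1 := by
  simp [norm_expI, toC]

/-- On `Q(∞)` the factor `exp(-Re t |k| ν / 2)` dominates the growth of `e^{i(k,x)}`. -/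
lemma norm_expI_mul_decay_le (hν : 0 < ν) (hα : 0 < α) (hα1 : α ≤ 1) {q : ℂ × (Fin 3 → ℂ)}
    (hq : q ∈ Q ν α) (k : Fin 3 → ℤ) :
    ‖expI k q.2‖ * decay ν k q.1 ≤ Real.exp (-(ν * q.1.re / 16 * eLen k)) := by
  rw [norm_expI, decay, ← Real.exp_add, Real.exp_le_exp]
  have hτ := re_pos_of_mem_sector hq.1
  have him : ∀ j, |(q.2 j).im| ≤ ν * q.1.re / 4 := by
    intro j
    have h1 := hq.2 j
    rw [div_mul_eq_mul_div, div_lt_iff₀ (by positivity)] at h1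
    have h2 : q.1.re * (ν * α) ≤ q.1.re * (ν * 1) := by gcongr
    linarith
  have h1 : -∑ j, (k j : ℝ) * (q.2 j).im ≤ ∑ j, |(k j : ℝ)| * (ν * q.1.re / 4) := by
    rw [← Finset.sum_neg_distrib]
    refine Finset.sum_le_sum fun j _ => ?_
    calc -((k j : ℝ) * (q.2 j).im) ≤ |(k j : ℝ) * (q.2 j).im| := neg_le_abs _
      _ = |(k j : ℝ)| * |(q.2 j).im| := abs_mul _ _
      _ ≤ _ := by gcongr; exact him j
  rw [← Finset.sum_mul] at h1
  -- The growth rate is at most `7/4 · 1/4 = 7/16` of `ν Re t |k|`, the decay rate is `8/16`, and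
  -- `1/16` remains.
  have h2 := mul_le_mul_of_nonneg_right (sum_abs_le_eLen k)
    (by positivity : 0 ≤ ν * q.1.re / 4)
  nlinarith

lemma summable_pow_mul_exp (n : ℕ) {ε : ℝ} (hε : 0 < ε) :
    Summable fun k : Fin 3 → ℤ => (1 + eLen k) ^ n * Real.exp (-(ε * eLen k)) := by
  have hfin : ∃ C, ∀ y : ℝ, 0 ≤ y → (1 + y) ^ (n + 4) * Real.exp (-(ε * y)) ≤ C := by
    -- From `z^m / m! ≤ e^z` at `z = ε(1 + y)`, `m = n + 4`. The four extra powers leave the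
    -- summable `|k|⁻⁴`.
    refine ⟨(n + 4).factorial * Real.exp (ε) / ε ^ (n + 4), fun y hy => ?_⟩
    have h1 := Real.pow_div_factorial_le_exp (ε * (1 + y)) (by positivity) (n + 4)
    rw [div_le_iff₀ (by positivity), mul_pow] at h1
    rw [le_div_iff₀ (by positivity)]
    calc (1 + y) ^ (n + 4) * Real.exp (-(ε * y)) * ε ^ (n + 4)
        = (ε ^ (n + 4) * (1 + y) ^ (n + 4)) * Real.exp (-(ε * y)) := by ring
      _ ≤ (Real.exp (ε * (1 + y)) * (n + 4).factorial) * Real.exp (-(ε * y)) := by gcongr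
      _ = (n + 4).factorial * (Real.exp (ε * (1 + y)) * Real.exp (-(ε * y))) := by ring
      _ = _ := by rw [← Real.exp_add]; ring_nf
  obtain ⟨C, hC⟩ := hfin
  have hs := (summable_inv_eLen_pow_four.mul_left C)
  refine Summable.of_norm_bounded_eventually hs ?_
  filter_upwards [(Set.finite_singleton (0 : Fin 3 → ℤ)).compl_mem_cofinite] with k hk
  have hk1 := one_le_eLen (k := k) (by simpa using hk)
  have h := hC (eLen k) (by linarith)
  rw [Real.norm_of_nonneg (by positivity), ← div_eq_mul_inv, le_div_iff₀ (by positivity)]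
  refine le_trans ?_ h
  rw [pow_add, mul_right_comm]
  gcongr
  linarith

end

section

variable {F : Type*} [NormedAddCommGroup F] [NormedSpace ℂ F] {ν α : ℝ}

/-- The sum of the Fourier series with coefficients `c k t`. -/
def fseries (c : (Fin 3 → ℤ) → ℂ → F) (t : ℂ) (x : Fin 3 → ℂ) : F := ∑' k, expI k x • c k t

/-- Coefficients that are holomorphic in the sector, with `exp(-Re t |k| ν / 2)` decay up to a
polynomial factor. -/
def GoodCoeff (ν : ℝ) (c : (Fin 3 → ℤ) → ℂ → F) : Prop :=
  ∃ (C : ℝ) (n : ℕ), 0 ≤ C ∧ ∀ k, DecayBound ν k (C * (1 + eLen k) ^ n) (c k)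

variable {c : (Fin 3 → ℤ) → ℂ → F}

lemma one_le_weight (k : Fin 3 → ℤ) : 1 ≤ 1 + eLen k := by linarith [eLen_nonneg k]

lemma GoodCoeff.of_le {M : (Fin 3 → ℤ) → ℝ} {C : ℝ} (n : ℕ) (hC : 0 ≤ C)
    (hM : ∀ k, M k ≤ C * (1 + eLen k) ^ n) (hc : ∀ k, DecayBound ν k (M k) (c k)) :
    GoodCoeff ν c := by
  refine ⟨C, n, hC, fun k => ⟨(hc k).holo, fun t ht => ((hc k).bound t ht).trans ?_⟩⟩
  exact mul_le_mul_of_nonneg_right (hM k) (decay_pos _ _ _).le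

/-- Near each point of `Q(∞)` the Fourier series of good coefficients converges normally. -/
lemma GoodCoeff.exists_bound (hν : 0 < ν) (hα : 0 < α) (hα1 : α ≤ 1) (hc : GoodCoeff ν c)
    {δ : ℝ} (hδ : 0 < δ) : ∃ b : (Fin 3 → ℤ) → ℝ, Summable b ∧
      ∀ k, ∀ q ∈ Q ν α ∩ {q | δ < q.1.re}, ‖expI k q.2 • c k q.1‖ ≤ b k := by
  obtain ⟨C, n, hC, h⟩ := hc
  refine ⟨_, (summable_pow_mul_exp n (by positivity : 0 < ν * δ / 16)).mul_left C, ?_⟩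
  rintro k q ⟨hq, hqδ⟩
  have hw := one_le_weight k
  have h0 := eLen_nonneg k
  rw [norm_smul]
  calc ‖expI k q.2‖ * ‖c k q.1‖
      ≤ ‖expI k q.2‖ * (C * (1 + eLen k) ^ n * decay ν k q.1) := by
        gcongr; exact (h k).bound _ hq.1
    _ = C * (1 + eLen k) ^ n * (‖expI k q.2‖ * decay ν k q.1) := by ring
    _ ≤ C * (1 + eLen k) ^ n * Real.exp (-(ν * δ / 16 * eLen k)) := by
        gcongr
        refine (norm_expI_mul_decay_le hν hα hα1 hq k).trans ?_
        rw [Real.exp_le_exp, neg_le_neg_iff]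
        have : δ ≤ q.1.re := le_of_lt hqδ
        gcongr
    _ = _ := by ring

lemma GoodCoeff.summable_norm (hν : 0 < ν) (hα : 0 < α) (hα1 : α ≤ 1) (hc : GoodCoeff ν c)
    {t : ℂ} {x : Fin 3 → ℂ} (hq : (t, x) ∈ Q ν α) : Summable fun k => ‖expI k x • c k t‖ := by
  have hτ := re_pos_of_mem_sector hq.1
  obtain ⟨b, hb, h⟩ := hc.exists_bound hν hα hα1 (half_pos hτ)
  exact Summable.of_nonneg_of_le (fun _ => norm_nonneg _)
    (fun k => h k (t, x) ⟨hq, by simpa using half_lt_self hτ⟩) hb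

lemma differentiable_expI (k : Fin 3 → ℤ) : Differentiable ℂ (expI k) := by
  unfold expI
  fun_prop

lemma hasFDerivAt_expI (k : Fin 3 → ℤ) (x : Fin 3 → ℂ) (l : Fin 3) :
    fderiv ℂ (expI k) x (Pi.single l 1) = expI k x * (Complex.I * k l) := by
  have h1 : HasFDerivAt (fun x : Fin 3 → ℂ => Complex.I * ∑ j, (k j : ℂ) * x j)
      (Complex.I • ∑ j, (k j : ℂ) • (ContinuousLinearMap.proj j : (Fin 3 → ℂ) →L[ℂ] ℂ)) x := by
    refine HasFDerivAt.const_mul ?_ _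
    refine HasFDerivAt.fun_sum fun j _ => ?_
    exact (ContinuousLinearMap.proj (R := ℂ) (φ := fun _ : Fin 3 => ℂ) j).hasFDerivAt.const_mul _
  have h2 : HasFDerivAt (expI k) (expI k x • Complex.I • ∑ j, (k j : ℂ) •
      (ContinuousLinearMap.proj j : (Fin 3 → ℂ) →L[ℂ] ℂ)) x := h1.cexp
  rw [h2.fderiv]
  simp [Pi.single_apply]

lemma GoodCoeff.differentiableOn_term (hc : GoodCoeff ν c) (k : Fin 3 → ℤ) :
    DifferentiableOn ℂ (fun q : ℂ × (Fin 3 → ℂ) => expI k q.2 • c k q.1) (Q ν α) := by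
  obtain ⟨C, n, hC, h⟩ := hc
  refine DifferentiableOn.smul ?_ ?_
  · exact ((differentiable_expI k).comp differentiable_snd).differentiableOn
  · exact (h k).holo.comp differentiable_fst.differentiableOn fun q hq => hq.1

lemma isOpen_Q_inter (ν α δ : ℝ) :
    IsOpen (Q ν α ∩ {q : ℂ × (Fin 3 → ℂ) | δ < q.1.re}) :=
  (isOpen_Q ν α).inter (isOpen_lt continuous_const (Complex.continuous_re.comp continuous_fst))

lemma GoodCoeff.differentiableOn [CompleteSpace F] (hν : 0 < ν) (hα : 0 < α) (hα1 : α ≤ 1)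
    (hc : GoodCoeff ν c) :
    DifferentiableOn ℂ (fun q : ℂ × (Fin 3 → ℂ) => fseries c q.1 q.2) (Q ν α) := by
  intro q hq
  have hτ := re_pos_of_mem_sector hq.1
  obtain ⟨b, hb, h⟩ := hc.exists_bound hν hα hα1 (half_pos hτ)
  exact (hasFDerivAt_tsum_of_holomorphic hb (isOpen_Q_inter _ _ _)
    (fun k => (hc.differentiableOn_term k).mono Set.inter_subset_left) h
    ⟨hq, by simpa using half_lt_self hτ⟩).2.differentiableAt.differentiableWithinAt

/-- Term by term differentiation in `t`. -/
lemma GoodCoeff.hasSum_deriv [CompleteSpace F] (hν : 0 < ν) (hα : 0 < α) (hα1 : α ≤ 1)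
    (hc : GoodCoeff ν c) {t : ℂ} {x : Fin 3 → ℂ} (hq : (t, x) ∈ Q ν α) :
    HasSum (fun k => expI k x • deriv (c k) t) (deriv (fun s => fseries c s x) t) := by
  have hτ := re_pos_of_mem_sector hq.1
  obtain ⟨b, hb, h⟩ := hc.exists_bound hν hα hα1 (half_pos hτ)
  set U := (fun s : ℂ => (s, x)) ⁻¹' (Q ν α ∩ {q : ℂ × (Fin 3 → ℂ) | t.re / 2 < q.1.re})
  have hU : IsOpen U := (isOpen_Q_inter _ _ _).preimage (by fun_prop)
  obtain ⟨C, n, hC, hk⟩ := hc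
  have hsec : ∀ s ∈ U, s ∈ sector := fun s hs => hs.1.1
  have hmem : t ∈ U := ⟨hq, by simpa using half_lt_self hτ⟩
  obtain ⟨h1, h2⟩ := hasFDerivAt_tsum_of_holomorphic (f := fun k s => expI k x • c k s) hb hU
    (fun k => ((hk k).holo.mono hsec).const_smul _) (fun k s hs => h k (s, x) hs) hmem
  have h3 := (ContinuousLinearMap.apply ℂ F (1 : ℂ)).hasSum h1.hasSum
  have h4 : deriv (fun s => fseries c s x) t =
      ContinuousLinearMap.apply ℂ F (1 : ℂ) (∑' k, fderiv ℂ (fun s => expI k x • c k s) t) :=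
    h2.hasDerivAt.deriv
  rw [h4]
  refine h3.congr_fun fun k => ?_
  have hd : DifferentiableAt ℂ (c k) t :=
    (hk k).holo.differentiableAt (isOpen_sector.mem_nhds hq.1)
  change _ = (fderiv ℂ (fun s => expI k x • c k s) t) 1
  rw [fderiv_apply_one_eq_deriv, deriv_fun_const_smul _ hd]

end

/-- Multiplication of the coefficients by `i k_l`. -/
def dcoeff (l : Fin 3) (c : (Fin 3 → ℤ) → ℂ → ℂ) : (Fin 3 → ℤ) → ℂ → ℂ :=
  fun k t => Complex.I * k l * c k t

section

variable {ν α : ℝ} {c : (Fin 3 → ℤ) → ℂ → ℂ}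

lemma GoodCoeff.dcoeff (hc : GoodCoeff ν c) (l : Fin 3) : GoodCoeff ν (dcoeff l c) := by
  obtain ⟨C, n, hC, h⟩ := hc
  refine ⟨C, n + 1, hC, fun k => ⟨(h k).holo.const_mul _, fun t ht => ?_⟩⟩
  have h1 := (h k).bound t ht
  have h2 : |(k l : ℝ)| ≤ 1 + eLen k := by linarith [abs_le_eLen k l]
  rw [NSTorus.dcoeff, norm_mul, norm_mul, Complex.norm_I, one_mul, Complex.norm_intCast]
  calc _ ≤ (1 + eLen k) * (C * (1 + eLen k) ^ n * decay ν k t) :=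
        mul_le_mul h2 h1 (norm_nonneg _) (by linarith [one_le_weight k])
    _ = _ := by ring

/-- Term by term differentiation in `x`. -/
lemma GoodCoeff.pderiv_fseries (hν : 0 < ν) (hα : 0 < α) (hα1 : α ≤ 1)
    (hc : GoodCoeff ν c) {t : ℂ} {x : Fin 3 → ℂ} (hq : (t, x) ∈ Q ν α) (l : Fin 3) :
    pderiv ℂ l (fseries c t) x = fseries (NSTorus.dcoeff l c) t x := by
  have hτ := re_pos_of_mem_sector hq.1
  obtain ⟨b, hb, h⟩ := hc.exists_bound hν hα hα1 (half_pos hτ)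
  set U := (fun y : Fin 3 → ℂ => (t, y)) ⁻¹'
    (Q ν α ∩ {q : ℂ × (Fin 3 → ℂ) | t.re / 2 < q.1.re})
  have hU : IsOpen U := (isOpen_Q_inter _ _ _).preimage (by fun_prop)
  have hmem : x ∈ U := ⟨hq, by simpa using half_lt_self hτ⟩
  obtain ⟨h1, h2⟩ := hasFDerivAt_tsum_of_holomorphic (f := fun k y => expI k y • c k t) hb hU
    (fun k => ((differentiable_expI k).differentiableOn).smul_const _)
    (fun k y hy => h k (t, y) hy) hmem
  have h3 := (ContinuousLinearMap.apply ℂ ℂ (Pi.single l 1 : Fin 3 → ℂ)).hasSum h1.hasSum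
  have h4 : pderiv ℂ l (fseries c t) x = ContinuousLinearMap.apply ℂ ℂ (Pi.single l 1 : Fin 3 → ℂ)
      (∑' k, fderiv ℂ (fun y => expI k y • c k t) x) := by
    rw [pderiv]
    change fderiv ℂ (fun y => ∑' k, expI k y • c k t) x (Pi.single l 1) = _
    rw [h2.fderiv]; rfl
  rw [h4, ← h3.tsum_eq, fseries]
  refine tsum_congr fun k => ?_
  change fderiv ℂ (fun y => expI k y • c k t) x (Pi.single l 1) = _
  rw [fderiv_smul_const (differentiable_expI k x), ContinuousLinearMap.smulRight_apply,
    hasFDerivAt_expI, NSTorus.dcoeff, smul_eq_mul, smul_eq_mul]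
  ring

lemma GoodCoeff.pderiv_pderiv_fseries (hν : 0 < ν) (hα : 0 < α) (hα1 : α ≤ 1)
    (hc : GoodCoeff ν c) {t : ℂ} {x : Fin 3 → ℂ} (hq : (t, x) ∈ Q ν α) (l : Fin 3) :
    pderiv ℂ l (pderiv ℂ l (fseries c t)) x =
      fseries (NSTorus.dcoeff l (NSTorus.dcoeff l c)) t x := by
  rw [← (hc.dcoeff l).pderiv_fseries hν hα hα1 hq l, pderiv, pderiv]
  congr 1
  -- The formula for the first derivative holds on a neighbourhood, `Q(∞)` being open, so it may be
  -- differentiated again.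
  refine Filter.EventuallyEq.fderiv_eq ?_
  have : IsOpen ((fun y : Fin 3 → ℂ => (t, y)) ⁻¹' Q ν α) := (isOpen_Q ν α).preimage (by fun_prop)
  filter_upwards [this.mem_nhds hq] with y hy
  exact hc.pderiv_fseries hν hα hα1 hy l

end

lemma expI_add (k l : Fin 3 → ℤ) (x : Fin 3 → ℂ) : expI (k + l) x = expI k x * expI l x := by
  rw [expI, expI, expI, ← Complex.exp_add, ← mul_add, ← Finset.sum_add_distrib]
  congr 2
  refine Finset.sum_congr rfl fun j _ => ?_
  push_cast [Pi.add_apply]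
  ring

/-- Products of Fourier series. -/
lemma GoodCoeff.hasSum_mul {ν α : ℝ} (hν : 0 < ν) (hα : 0 < α) (hα1 : α ≤ 1)
    {c d : (Fin 3 → ℤ) → ℂ → ℂ} (hc : GoodCoeff ν c) (hd : GoodCoeff ν d) {t : ℂ}
    {x : Fin 3 → ℂ} (hq : (t, x) ∈ Q ν α) :
    HasSum (fun k => expI k x * conv (fun l => c l t) (fun l => d l t) k)
      (fseries c t x * fseries d t x) := by
  refine (hasSum_conv (hc.summable_norm hν hα hα1 hq) (hd.summable_norm hν hα hα1 hq)).congr_fun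
    fun k => ?_
  rw [conv, conv, ← tsum_mul_left]
  refine tsum_congr fun l => ?_
  have : expI k x = expI l x * expI (k - l) x := by rw [← expI_add, add_sub_cancel]
  rw [this, smul_eq_mul, smul_eq_mul]
  ring

/-! ### Fourier coefficients on the torus. -/

lemma measurableSet_cube : MeasurableSet cube :=
  MeasurableSet.univ_pi fun _ => measurableSet_Ioc

lemma restrict_cube : (volume : Measure (Fin 3 → ℝ)).restrict cube =
    Measure.pi fun _ => (volume : Measure ℝ).restrict (Set.Ioc 0 (2 * Real.pi)) := by
  rw [volume_pi, cube, Measure.restrict_pi_pi]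

instance isFiniteMeasure_restrict_cube :
    IsFiniteMeasure ((volume : Measure (Fin 3 → ℝ)).restrict cube) := by
  rw [restrict_cube]; infer_instance

@[simp] lemma expI_zero (x : Fin 3 → ℂ) : expI 0 x = 1 := by simp [expI]

lemma continuous_expI_toC (k : Fin 3 → ℤ) : Continuous fun x : Fin 3 → ℝ => expI k (toC x) := by
  unfold expI toC
  fun_prop

lemma conj_expI_toC (k : Fin 3 → ℤ) (x : Fin 3 → ℝ) :
    starRingEnd ℂ (expI k (toC x)) = expI (-k) (toC x) := by
  rw [expI, expI, ← Complex.exp_conj]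
  simp [toC, map_sum]

/-- Orthogonality of the exponentials. -/
lemma integral_expI (k : Fin 3 → ℤ) :
    ∫ x in cube, expI k (toC x) = if k = 0 then (2 * Real.pi : ℂ) ^ 3 else 0 := by
  have hprod : ∀ x : Fin 3 → ℝ, expI k (toC x) =
      ∏ j, Complex.exp (Complex.I * k j * (x j : ℂ)) := by
    intro x
    rw [← Complex.exp_sum, expI, Finset.mul_sum]
    simp [toC, mul_assoc]
  have hone : ∀ n : ℤ, ∫ y in Set.Ioc 0 (2 * Real.pi), Complex.exp (Complex.I * n * (y : ℂ)) =
      if n = 0 then (2 * Real.pi : ℂ) else 0 := by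
    intro n
    rw [← intervalIntegral.integral_of_le Real.two_pi_pos.le]
    split_ifs with hn
    · simp [hn]
    · have hc : Complex.I * n ≠ 0 := by simp [hn]
      rw [integral_exp_mul_complex hc]
      have h1 : Complex.exp (Complex.I * n * ((2 * Real.pi : ℝ) : ℂ)) = 1 := by
        rw [Complex.exp_eq_one_iff]
        exact ⟨n, by push_cast; ring⟩
      rw [h1]; simp
  rw [restrict_cube]
  simp_rw [hprod]
  rw [integral_fintype_prod_eq_prod
    (f := fun j (y : ℝ) => Complex.exp (Complex.I * k j * (y : ℂ)))]
  simp_rw [hone]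
  split_ifs with hk
  · simp [hk]
  · obtain ⟨j, hj⟩ := Function.ne_iff.1 hk
    exact Finset.prod_eq_zero (Finset.mem_univ j) (if_neg hj)

lemma two_pi_pow_ne_zero : (2 * Real.pi : ℂ) ^ 3 ≠ 0 := by
  have := Real.pi_ne_zero
  simp [this]

section

variable {E : Type*} [NormedAddCommGroup E] [NormedSpace ℂ E] {f g : (Fin 3 → ℝ) → E}

lemma integrable_expI_smul (hf : Integrable f (volume.restrict cube)) (k : Fin 3 → ℤ) :
    Integrable (fun x => expI k (toC x) • f x) (volume.restrict cube) :=
  hf.bdd_smul 1 (continuous_expI_toC k).aestronglyMeasurable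
    (Eventually.of_forall fun x => (norm_expI_toC k x).le)

lemma coeff_sub (hf : Integrable f (volume.restrict cube))
    (hg : Integrable g (volume.restrict cube)) (k : Fin 3 → ℤ) :
    coeff (f - g) k = coeff f k - coeff g k := by
  rw [coeff, coeff, coeff, ← smul_sub,
    ← integral_sub (integrable_expI_smul hf _) (integrable_expI_smul hg _)]
  simp only [Pi.sub_apply, smul_sub]

lemma coeff_congr_ae (h : f =ᵐ[volume.restrict cube] g) (k : Fin 3 → ℤ) :
    coeff f k = coeff g k := by
  rw [coeff, coeff]
  congr 1
  refine integral_congr_ae ?_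
  filter_upwards [h] with x hx
  rw [hx]

lemma h1Norm_congr_ae (h : f =ᵐ[volume.restrict cube] g) : h1Norm f = h1Norm g := by
  simp only [h1Norm, coeff_congr_ae h]

lemma coeff_zero_eq (f : (Fin 3 → ℝ) → E) :
    coeff f 0 = ((2 * Real.pi : ℂ) ^ 3)⁻¹ • ∫ x in cube, f x := by
  simp [coeff]

lemma MemH1.coeff_zero (h : MemH1 f) : coeff f 0 = 0 := by
  rw [coeff_zero_eq, h.zero_mean, smul_zero]

lemma MemH1.integrable (h : MemH1 f) : Integrable f (volume.restrict cube) :=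
  h.memLp.integrable (by norm_num)

lemma h1Norm_eq (h : Summable fun k => ‖coeff f k‖ ^ 2 * eLen k ^ 2) :
    h1Norm f = ENNReal.ofReal (Real.sqrt (∑' k, ‖coeff f k‖ ^ 2 * eLen k ^ 2)) := by
  rw [h1Norm, ← ENNReal.ofReal_tsum_of_nonneg (fun _ => by positivity) h, Real.sqrt_eq_rpow,
    ENNReal.ofReal_rpow_of_nonneg (tsum_nonneg fun _ => by positivity) (by norm_num)]

lemma summable_of_h1Norm_lt_top (h : h1Norm f < ⊤) :
    Summable fun k => ‖coeff f k‖ ^ 2 * eLen k ^ 2 := by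
  rw [h1Norm, ENNReal.rpow_lt_top_iff_of_pos (by norm_num)] at h
  have := ENNReal.summable_toReal h.ne
  refine this.congr fun k => ?_
  rw [ENNReal.toReal_ofReal (by positivity)]

/-- The coefficients of an absolutely convergent Fourier series. -/
lemma coeff_tsum [CompleteSpace E] {c : (Fin 3 → ℤ) → E} (hc : Summable fun k => ‖c k‖)
    (k : Fin 3 → ℤ) : coeff (fun x => ∑' m, expI m (toC x) • c m) k = c k := by
  have h1 : ∀ x : Fin 3 → ℝ, expI (-k) (toC x) • ∑' m, expI m (toC x) • c m =
      ∑' m, expI (m - k) (toC x) • c m := by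
    intro x
    have hs : Summable fun m => expI m (toC x) • c m :=
      Summable.of_norm (by simpa [norm_smul, norm_expI_toC] using hc)
    rw [← hs.tsum_const_smul]
    refine tsum_congr fun m => ?_
    rw [smul_smul, ← expI_add, neg_add_eq_sub]
  have hint : ∀ m, Integrable (fun x => expI (m - k) (toC x) • c m) (volume.restrict cube) :=
    fun m => integrable_expI_smul (integrable_const _) _
  have hsum := hasSum_integral_of_summable_integral_norm hint (by
    simp only [norm_smul, norm_expI_toC, one_mul, integral_const, smul_eq_mul]
    exact hc.mul_left _)
  have h2 : ∀ m, ∫ x in cube, expI (m - k) (toC x) • c m =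
      if m = k then (2 * Real.pi : ℂ) ^ 3 • c m else 0 := by
    intro m
    rw [integral_smul_const, integral_expI]
    simp only [sub_eq_zero]
    split_ifs <;> simp
  rw [coeff]
  simp_rw [h1]
  rw [← hsum.tsum_eq]
  simp_rw [h2]
  rw [tsum_ite_eq, smul_smul, inv_mul_cancel₀ two_pi_pow_ne_zero, one_smul]

lemma continuous_tsum_expI [CompleteSpace E] {c : (Fin 3 → ℤ) → E} (hc : Summable fun k => ‖c k‖) :
    Continuous fun x : Fin 3 → ℝ => ∑' m, expI m (toC x) • c m :=
  continuous_tsum (fun m => (continuous_expI_toC m).smul continuous_const) hc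
    fun m x => by rw [norm_smul, norm_expI_toC, one_mul]

lemma integrable_tsum_expI [CompleteSpace E] {c : (Fin 3 → ℤ) → E} (hc : Summable fun k => ‖c k‖) :
    Integrable (fun x : Fin 3 → ℝ => ∑' m, expI m (toC x) • c m) (volume.restrict cube) := by
  refine Integrable.of_bound (μ := volume.restrict cube)
    (continuous_tsum_expI hc).aestronglyMeasurable (∑' k, ‖c k‖) (Eventually.of_forall fun x => ?_)
  have : ∀ m, ‖expI m (toC x) • c m‖ = ‖c m‖ := fun m => by
    rw [norm_smul, norm_expI_toC, one_mul]
  calc _ ≤ ∑' m, ‖expI m (toC x) • c m‖ := norm_tsum_le_tsum_norm (by simpa [this] using hc)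
    _ = _ := by simp only [this]

end

/-- The `L²` class of `e^{i(k,x)}` on the fundamental cube. -/
def expLp (k : Fin 3 → ℤ) : Lp ℂ 2 ((volume : Measure (Fin 3 → ℝ)).restrict cube) :=
  MemLp.toLp (fun x => expI k (toC x)) (MemLp.of_bound
    (continuous_expI_toC k).aestronglyMeasurable 1
    (Eventually.of_forall fun x => (norm_expI_toC k x).le))

lemma inner_expLp (k : Fin 3 → ℤ) (f : Lp ℂ 2 ((volume : Measure (Fin 3 → ℝ)).restrict cube)) :
    inner ℂ (expLp k) f = (2 * Real.pi : ℂ) ^ 3 * coeff f k := by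
  rw [L2.inner_def, coeff, smul_eq_mul, mul_inv_cancel_left₀ two_pi_pow_ne_zero]
  refine integral_congr_ae ?_
  filter_upwards [MemLp.coeFn_toLp (MemLp.of_bound (μ := (volume : Measure (Fin 3 → ℝ)).restrict cube)
    (p := 2) (continuous_expI_toC k).aestronglyMeasurable 1
    (Eventually.of_forall fun x => (norm_expI_toC k x).le))] with x hx
  rw [expLp, hx, RCLike.inner_apply, conj_expI_toC, smul_eq_mul, mul_comm]

lemma inner_expLp_expLp (k m : Fin 3 → ℤ) :
    inner ℂ (expLp k) (expLp m) = if k = m then (2 * Real.pi : ℂ) ^ 3 else 0 := by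
  have h : expLp m =ᵐ[volume.restrict cube] fun x => expI m (toC x) := MemLp.coeFn_toLp _
  rw [inner_expLp, coeff_congr_ae h, coeff, smul_eq_mul,
    mul_inv_cancel_left₀ two_pi_pow_ne_zero]
  simp_rw [smul_eq_mul, ← expI_add]
  rw [integral_expI]
  simp only [neg_add_eq_zero]

/-- The reduction of a point of `ℝ³` to the fundamental cube. -/
def reduce (x : Fin 3 → ℝ) : Fin 3 → ℝ := fun j => toIocMod Real.two_pi_pos 0 (x j)

lemma reduce_eq_self {x : Fin 3 → ℝ} (hx : x ∈ cube) : reduce x = x := by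
  ext j
  rw [reduce, toIocMod_eq_self, zero_add]
  exact hx j (Set.mem_univ j)

lemma reduce_add (x : Fin 3 → ℝ) (j : Fin 3) :
    reduce (x + Pi.single j (2 * Real.pi)) = reduce x := by
  ext i
  rw [reduce, reduce, Pi.add_apply]
  rcases eq_or_ne i j with rfl | h
  · rw [Pi.single_eq_same, toIocMod_add_right]
  · rw [Pi.single_eq_of_ne h, add_zero]

/-- Riesz-Fischer: a weighted square summable sequence is the sequence of Fourier coefficients of
a function of class `H¹`. -/
lemma IsH1Seq.exists_memH1 {A : (Fin 3 → ℤ) → ℝ} (hA : IsH1Seq A) :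
    ∃ f : (Fin 3 → ℝ) → ℂ, MemH1 f ∧ ∀ k, coeff f k = A k := by
  set N : ℝ := (2 * Real.pi) ^ 3 with hN
  have hN0 : 0 < N := by positivity
  have hNC : (2 * Real.pi : ℂ) ^ 3 = (N : ℂ) := by rw [hN]; push_cast; rfl
  have hsq : (Real.sqrt N : ℂ) * Real.sqrt N = N := by
    rw [← Complex.ofReal_mul, Real.mul_self_sqrt hN0.le]
  have hsq0 : (Real.sqrt N : ℂ) ≠ 0 := by
    exact_mod_cast (Real.sqrt_pos.2 hN0).ne'
  have hw : Orthonormal ℂ fun k => ((Real.sqrt N : ℂ)⁻¹) • expLp k := by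
    classical
    rw [orthonormal_iff_ite]
    intro k m
    rw [inner_smul_left, inner_smul_right, inner_expLp_expLp, hNC, map_inv₀, Complex.conj_ofReal]
    split_ifs
    · rw [← hsq]; field_simp
    · simp
  -- The exponentials have `L²` norm `√N` on the cube, hence this factor relative to the orthonormal
  -- system.
  have hb : Memℓp (fun k => (Real.sqrt N : ℂ) * A k) 2 := by
    refine memℓp_gen ?_
    have : ∀ k, ‖(Real.sqrt N : ℂ) * A k‖ ^ (2 : ℝ≥0∞).toReal = N * A k ^ 2 := by
      intro k
      rw [ENNReal.toReal_ofNat, Real.rpow_two, norm_mul, mul_pow, Complex.norm_real,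
        Complex.norm_real, Real.norm_eq_abs, Real.norm_eq_abs, sq_abs, sq_abs, Real.sq_sqrt hN0.le]
    simp_rw [this]
    exact hA.summable_sq.mul_left N
  set b : lp (fun _ : Fin 3 → ℤ => ℂ) 2 := ⟨_, hb⟩
  set g := hw.orthogonalFamily.linearIsometry b with hg
  have hinner : ∀ k, inner ℂ (expLp k) g = (N : ℂ) * A k := by
    classical
    intro k
    have h1 : ((Real.sqrt N : ℂ)⁻¹) • expLp k =
        hw.orthogonalFamily.linearIsometry (lp.single 2 k (1 : ℂ)) := by
      rw [OrthogonalFamily.linearIsometry_apply_single]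
      simp
    have h2 : inner ℂ (((Real.sqrt N : ℂ)⁻¹) • expLp k) g = (Real.sqrt N : ℂ) * A k := by
      rw [h1, hg, LinearIsometry.inner_map_map, lp.inner_single_left]
      simp [b]
    rw [inner_smul_left, map_inv₀, Complex.conj_ofReal, inv_mul_eq_iff_eq_mul₀ hsq0] at h2
    rw [h2, ← mul_assoc, hsq]
  -- Periodicity is required pointwise on `ℝ³`, so the `L²` representative is extended periodically
  -- from the cube.
  have hae : (fun x => g (reduce x)) =ᵐ[volume.restrict cube] g := by
    filter_upwards [ae_restrict_mem measurableSet_cube] with x hx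
    rw [reduce_eq_self hx]
  have hcoeff : ∀ k, coeff (fun x => g (reduce x)) k = A k := by
    intro k
    have h := hinner k
    rw [inner_expLp, hNC] at h
    rw [coeff_congr_ae hae]
    exact mul_left_cancel₀ (by exact_mod_cast hN0.ne') h
  refine ⟨fun x => g (reduce x), ⟨fun x j => by simp only [reduce_add],
    (memLp_congr_ae hae).2 (Lp.memLp g), ?_, ?_⟩, hcoeff⟩
  · have h0 := hcoeff 0
    rw [coeff_zero_eq, hA.zero, Complex.ofReal_zero, smul_eq_mul, mul_eq_zero] at h0
    exact h0.resolve_left (inv_ne_zero two_pi_pow_ne_zero)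
  · rw [h1Norm_eq]
    · exact ENNReal.ofReal_lt_top
    · refine hA.summable.congr fun k => ?_
      rw [hcoeff, Complex.norm_real, Real.norm_eq_abs, sq_abs, mul_comm]

section

variable {f : (Fin 3 → ℝ) → Vec}

/-- A weakly divergence free field has Fourier coefficients orthogonal to the wave vectors. -/
lemma WeaklyDivFree.dotK_coeff (h : WeaklyDivFree f) (hf : Integrable f (volume.restrict cube))
    (k : Fin 3 → ℤ) : dotK k (coeff f k) = 0 := by
  have hlin : ∀ x : Fin 3 → ℝ, HasFDerivAt (fun x : Fin 3 → ℝ => expI (-k) (toC x))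
      (expI (-k) (toC x) • Complex.I • ∑ j, ((-k) j : ℂ) •
        (Complex.ofRealCLM.comp (ContinuousLinearMap.proj j : (Fin 3 → ℝ) →L[ℝ] ℝ))) x := by
    intro x
    have h1 : HasFDerivAt (fun x : Fin 3 → ℝ => Complex.I * ∑ j, ((-k) j : ℂ) * toC x j)
        (Complex.I • ∑ j, ((-k) j : ℂ) •
        (Complex.ofRealCLM.comp (ContinuousLinearMap.proj j : (Fin 3 → ℝ) →L[ℝ] ℝ))) x := by
      refine HasFDerivAt.const_mul ?_ _
      refine HasFDerivAt.fun_sum fun j _ => ?_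
      exact (Complex.ofRealCLM.comp
        (ContinuousLinearMap.proj (R := ℝ) (φ := fun _ : Fin 3 => ℝ) j)).hasFDerivAt.const_mul _
    exact h1.cexp
  have hpd : ∀ (x : Fin 3 → ℝ) (j : Fin 3), pderiv ℝ j (fun x => expI (-k) (toC x)) x =
      expI (-k) (toC x) * (-Complex.I * k j) := by
    intro x j
    rw [pderiv, (hlin x).fderiv]
    simp [Pi.single_apply, apply_ite]
  have hsm : ContDiff ℝ (⊤ : ℕ∞) fun x : Fin 3 → ℝ => expI (-k) (toC x) := by
    unfold expI toC
    refine ContDiff.cexp (contDiff_const.mul (ContDiff.sum fun j _ => contDiff_const.mul ?_))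
    exact (Complex.ofRealCLM.comp
      (ContinuousLinearMap.proj (R := ℝ) (φ := fun _ : Fin 3 => ℝ) j)).contDiff
  have hper : IsPeriodic fun x : Fin 3 → ℝ => expI (-k) (toC x) := by
    intro x j
    simp only [expI]
    rw [Complex.exp_eq_exp_iff_exists_int]
    refine ⟨-k j, ?_⟩
    have : ∀ i, (((-k) i : ℤ) : ℂ) * toC (x + Pi.single j (2 * Real.pi)) i =
        ((-k) i : ℤ) * toC x i + if i = j then ((-k) j : ℤ) * (2 * Real.pi : ℂ) else 0 := by
      intro i
      rcases eq_or_ne i j with rfl | hij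
      · simp [toC]; ring
      · simp [toC, hij]
    simp_rw [this]
    rw [Finset.sum_add_distrib]
    simp
    ring
  -- The test function is `e^{-i(k,x)}`; its gradient brings down `-ik`.
  have h0 := h _ hsm hper
  have he : ∀ x : Fin 3 → ℝ, ∑ j, f x j * pderiv ℝ j (fun x => expI (-k) (toC x)) x =
      -Complex.I * dotK k (expI (-k) (toC x) • f x) := by
    intro x
    rw [map_smul, dotK_apply, smul_eq_mul, Finset.mul_sum, Finset.mul_sum]
    refine Finset.sum_congr rfl fun j _ => ?_
    rw [hpd]; ring
  simp_rw [he] at h0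
  rw [integral_const_mul, ContinuousLinearMap.integral_comp_comm _ (integrable_expI_smul hf _)]
    at h0
  rw [coeff, map_smul, smul_eq_mul]
  rw [mul_eq_zero] at h0
  rw [h0.resolve_left (by simp), mul_zero]

lemma coeff_neg_of_real (hf : ∀ x j, (f x j).im = 0) (k : Fin 3 → ℤ) :
    coeff f (-k) = conjV (coeff f k) := by
  have hconj : ∀ x, conjV (f x) = f x := fun x => by
    ext j
    exact Complex.conj_eq_iff_im.2 (hf x j)
  have hI := conjVEquiv.integral_comp_comm (μ := volume.restrict cube)
    fun x => expI (-k) (toC x) • f x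
  change ∫ x in cube, conjV (expI (-k) (toC x) • f x) = conjV _ at hI
  rw [coeff, coeff, conjV_smul, ← hI]
  congr 1
  · simp [Complex.conj_ofNat]
  · refine integral_congr_ae (Eventually.of_forall fun x => ?_)
    simp only
    rw [conjV_smul, hconj, conj_expI_toC]

end

/-! ### Velocity, pressure and the Navier-Stokes equations. -/

lemma sum_norm_le (a : Vec) : ∑ j, ‖a j‖ ≤ 2 * ‖a‖ := by
  refine abs_le_of_sq_le_sq' ?_ (by positivity) |>.2
  rw [mul_pow, EuclideanSpace.norm_sq_eq]
  simp only [Fin.sum_univ_three]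
  nlinarith [sq_nonneg (‖a 0‖ - ‖a 1‖), sq_nonneg (‖a 0‖ - ‖a 2‖), sq_nonneg (‖a 1‖ - ‖a 2‖),
    sq_nonneg ‖a 0‖, sq_nonneg ‖a 1‖, sq_nonneg ‖a 2‖]

lemma norm_le_sum (a : Vec) : ‖a‖ ≤ ∑ j, ‖a j‖ := by
  refine abs_le_of_sq_le_sq' ?_ (Finset.sum_nonneg fun _ _ => norm_nonneg _) |>.2
  rw [EuclideanSpace.norm_sq_eq]
  simp only [Fin.sum_univ_three]
  have h0 := norm_nonneg (a 0)
  have h1 := norm_nonneg (a 1)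
  have h2 := norm_nonneg (a 2)
  nlinarith [mul_nonneg h0 h1, mul_nonneg h0 h2, mul_nonneg h1 h2]

/-- The symbol `(a, b) ↦ -(k, a) (k, b) / |k|²` of the pressure. -/
def pressureSymbol (k : Fin 3 → ℤ) : Vec →L[ℂ] Vec →L[ℂ] ℂ :=
  (-((eLen k : ℂ) ^ 2)⁻¹) • (ContinuousLinearMap.mul ℂ ℂ).bilinearComp (dotK k) (dotK k)

lemma pressureSymbol_apply (k : Fin 3 → ℤ) (a b : Vec) :
    pressureSymbol k a b = -((eLen k : ℂ) ^ 2)⁻¹ * (dotK k a * dotK k b) := by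
  simp [pressureSymbol]

lemma norm_pressureSymbol_le (k : Fin 3 → ℤ) (a b : Vec) :
    ‖pressureSymbol k a b‖ ≤ 1 * ‖a‖ * ‖b‖ := by
  rw [pressureSymbol_apply, norm_mul, norm_mul, norm_neg, norm_inv, norm_pow, Complex.norm_real,
    Real.norm_of_nonneg (eLen_nonneg k)]
  rcases eq_or_ne k 0 with rfl | hk
  · simp only [eLen_zero, ne_eq, OfNat.ofNat_ne_zero, not_false_eq_true, zero_pow, inv_zero,
      zero_mul]
    positivity
  · have h1 := one_le_eLen hk
    calc (eLen k ^ 2)⁻¹ * (‖dotK k a‖ * ‖dotK k b‖)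
        ≤ (eLen k ^ 2)⁻¹ * ((eLen k * ‖a‖) * (eLen k * ‖b‖)) := by
          gcongr <;> exact norm_dotK_le _ _
      _ = 1 * ‖a‖ * ‖b‖ := by field_simp

/-- The velocity field with initial value `vhat` and Fourier coefficients `u`. -/
def velocity (vhat : (Fin 3 → ℝ) → Vec) (u : (Fin 3 → ℤ) → ℂ → Vec) (t : ℂ) (x : Fin 3 → ℂ) :
    Vec :=
  -- The value at `t = 0` is prescribed, since `u` is controlled only on the open sector, which
  -- omits `0`.
  if t = 0 then vhat fun j => (x j).re
  else WithLp.toLp 2 fun j => fseries (fun k s => u k s j) t x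

/-- The Fourier coefficients of the pressure. -/
def pressureCoeff (u : (Fin 3 → ℤ) → ℂ → Vec) (k : Fin 3 → ℤ) (t : ℂ) : ℂ :=
  bconv (pressureSymbol k) u k t

lemma ne_zero_of_mem_sector {t : ℂ} (ht : t ∈ sector) : t ≠ 0 := by
  rintro rfl
  simpa using re_pos_of_mem_sector ht

lemma GoodCoeff.summable_norm_coeff {F : Type*} [NormedAddCommGroup F] [NormedSpace ℂ F] {ν : ℝ}
    (hν : 0 < ν) {c : (Fin 3 → ℤ) → ℂ → F} (hc : GoodCoeff ν c) {t : ℂ} (ht : t ∈ sector) :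
    Summable fun k => ‖c k t‖ := by
  -- At a real point the exponentials have modulus `1`, and real points lie in `Q ν α` for every
  -- `α`.
  have h := hc.summable_norm hν one_pos le_rfl (toC_mem_Q (ν := ν) (α := 1) ht 0)
  simpa [norm_smul, norm_expI_toC] using h

section

variable {ν : ℝ} {u : (Fin 3 → ℤ) → ℂ → Vec} {V : (Fin 3 → ℤ) → ℝ}

lemma Majorized.goodCoeff (hu : Majorized ν u V) (hV : IsH1Seq V) : GoodCoeff ν u := by
  refine GoodCoeff.of_le (C := 1 + ∑' k, V k ^ 2) 0
    (add_nonneg zero_le_one (tsum_nonneg fun _ => sq_nonneg _)) (fun k => ?_) hu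
  have := hV.summable_sq.le_tsum k fun _ _ => sq_nonneg _
  nlinarith [sq_nonneg (V k - 1)]

lemma GoodCoeff.coord (hu : GoodCoeff ν u) (j : Fin 3) : GoodCoeff ν fun k t => u k t j := by
  obtain ⟨C, n, hC, h⟩ := hu
  refine ⟨C, n, hC, fun k => ⟨?_, fun t ht => ?_⟩⟩
  · exact (EuclideanSpace.proj (𝕜 := ℂ) j).differentiable.comp_differentiableOn (h k).holo
  · exact (PiLp.norm_apply_le _ _).trans ((h k).bound t ht)

lemma Majorized.goodCoeff_pressure (hν : 0 < ν) (hu : Majorized ν u V) (hV : IsH1Seq V) :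
    GoodCoeff ν (pressureCoeff u) := by
  refine GoodCoeff.of_le (C := ∑' k, V k ^ 2) 0 (tsum_nonneg fun _ => sq_nonneg _) (fun k => ?_)
    fun k => hu.bconv hν hV zero_le_one (norm_pressureSymbol_le k) k
  rw [one_mul, pow_zero, mul_one]
  exact hV.conv_le k

lemma velocity_apply {vhat : (Fin 3 → ℝ) → Vec} {t : ℂ} (ht : t ≠ 0) (x : Fin 3 → ℂ) (j : Fin 3) :
    velocity vhat u t x j = fseries (fun k s => u k s j) t x := by
  rw [velocity, if_neg ht]

lemma GoodCoeff.velocity_eq {vhat : (Fin 3 → ℝ) → Vec} {α : ℝ} (hν : 0 < ν) (hα : 0 < α)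
    (hα1 : α ≤ 1) (hu : GoodCoeff ν u) {t : ℂ} {x : Fin 3 → ℂ} (hq : (t, x) ∈ Q ν α) :
    velocity vhat u t x = fseries u t x := by
  ext j
  rw [velocity_apply (ne_zero_of_mem_sector hq.1)]
  exact ((EuclideanSpace.proj (𝕜 := ℂ) j).map_tsum
    (hu.summable_norm hν hα hα1 hq).of_norm).symm

lemma GoodCoeff.onReal_velocity_eq {vhat : (Fin 3 → ℝ) → Vec} (hν : 0 < ν)
    (hu : GoodCoeff ν u) {t : ℂ} (ht : t ∈ sector) :
    onReal (velocity vhat u t) = fun x => ∑' k, expI k (toC x) • u k t := by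
  ext1 x
  exact hu.velocity_eq hν one_pos le_rfl (toC_mem_Q ht x)

lemma GoodCoeff.coeff_velocity {vhat : (Fin 3 → ℝ) → Vec} (hν : 0 < ν) (hu : GoodCoeff ν u)
    {t : ℂ} (ht : t ∈ sector) (k : Fin 3 → ℤ) :
    coeff (onReal (velocity vhat u t)) k = u k t := by
  rw [hu.onReal_velocity_eq hν ht, coeff_tsum (hu.summable_norm_coeff hν ht)]

lemma summable_norm_mul_sub {R : Type*} [NormedRing R] {f g : (Fin 3 → ℤ) → R}
    (hf : Summable fun k => ‖f k‖) (hg : Summable fun k => ‖g k‖) (k : Fin 3 → ℤ) :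
    Summable fun l => ‖f l * g (k - l)‖ :=
  (summable_norm_shear hf hg).prod_factor k

lemma hasSum_coord {ι : Type*} {f : ι → Vec} {a : Vec} (h : HasSum f a) (j : Fin 3) :
    HasSum (fun i => f i j) (a j) :=
  (EuclideanSpace.proj (𝕜 := ℂ) j).hasSum h

/-- The algebraic identity between the transport term, the projected nonlinearity and the
pressure gradient in Fourier variables. -/
lemma Majorized.sum_conv_eq (hν : 0 < ν) (hu : Majorized ν u V) (hV : IsH1Seq V) {t : ℂ}
    (ht : t ∈ sector) (hdiv : ∀ k, dotK k (u k t) = 0) (k : Fin 3 → ℤ) (j : Fin 3) :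
    ∑ l, conv (fun m => u m t l) (fun m => dcoeff l (fun n s => u n s j) m t) k =
      NSTorus.bconv (NSTorus.nlin k) u k t j - Complex.I * k j * pressureCoeff u k t := by
  have hg := hu.goodCoeff hV
  have hsum : ∀ l, Summable fun m => u m t l * dcoeff l (fun n s => u n s j) (k - m) t := fun l =>
    (summable_norm_mul_sub ((hg.coord l).summable_norm_coeff hν ht)
      (((hg.coord j).dcoeff l).summable_norm_coeff hν ht) k).of_norm
  have hN := (hu.summable_bilin hν hV (two_eLen_nonneg k) (norm_nlin_le k) ht k).of_norm
  have hP := (hu.summable_bilin hν hV zero_le_one (norm_pressureSymbol_le k) ht k).of_norm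
  have hNj := hasSum_coord hN.hasSum j
  simp only [conv]
  rw [← Summable.tsum_finsetSum fun l _ => hsum l, pressureCoeff, NSTorus.bconv, NSTorus.bconv,
    ← hNj.tsum_eq, ← tsum_mul_left, ← hNj.summable.tsum_sub (hP.mul_left _)]
  refine tsum_congr fun m => ?_
  have h1 : ∑ l, u m t l * dcoeff l (fun n s => u n s j) (k - m) t =
      Complex.I * dotK k (u m t) * u (k - m) t j := by
    -- Incompressibility `(m, u_m) = 0` turns the transport term into divergence form. The part of
    -- `u_{k-m}` along `k` is then the pressure gradient.
    have h2 : dotK k (u m t) = dotK (k - m) (u m t) := by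
      have : dotK (k - m) (u m t) = dotK k (u m t) - dotK m (u m t) := by
        simp only [dotK_apply, ← Finset.sum_sub_distrib]
        refine Finset.sum_congr rfl fun i _ => ?_
        rw [Pi.sub_apply]; push_cast; ring
      rw [this, hdiv, sub_zero]
    rw [h2, dotK_apply, Finset.mul_sum, Finset.sum_mul]
    refine Finset.sum_congr rfl fun l _ => ?_
    rw [dcoeff]; ring
  rw [h1, nlin_apply, leray_apply, pressureSymbol_apply]
  simp only [PiLp.smul_apply, PiLp.sub_apply, smul_eq_mul, waveVec_apply]
  ring

lemma expI_add_single (k : Fin 3 → ℤ) (x : Fin 3 → ℂ) (j : Fin 3) :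
    expI k (x + Pi.single j (2 * Real.pi : ℂ)) = expI k x := by
  simp only [expI]
  rw [Complex.exp_eq_exp_iff_exists_int]
  refine ⟨k j, ?_⟩
  have : ∀ i, (k i : ℂ) * (x + Pi.single j (2 * Real.pi : ℂ) : Fin 3 → ℂ) i =
      k i * x i + if i = j then k j * (2 * Real.pi : ℂ) else 0 := by
    intro i
    rcases eq_or_ne i j with rfl | hij
    · simp; ring
    · simp [hij]
  simp_rw [this]
  rw [Finset.sum_add_distrib]
  simp
  ring

lemma GoodCoeff.hasSum {α : ℝ} (hν : 0 < ν) (hα : 0 < α) (hα1 : α ≤ 1)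
    {c : (Fin 3 → ℤ) → ℂ → ℂ} (hc : GoodCoeff ν c) {t : ℂ} {x : Fin 3 → ℂ} (hq : (t, x) ∈ Q ν α) :
    HasSum (fun k => expI k x * c k t) (fseries c t x) :=
  (hc.summable_norm hν hα hα1 hq).of_norm.hasSum

/-- The Fourier series of a solution of the integral equations solves the Navier-Stokes
equations. -/
lemma Majorized.solvesNS {α : ℝ} {vhat : (Fin 3 → ℝ) → Vec} (hν : 0 < ν) (hα : 0 < α)
    (hα1 : α ≤ 1) (hu : Majorized ν u V) (hV : IsH1Seq V)
    (hderiv : ∀ k, ∀ t ∈ sector, HasDerivAt (u k)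
      (-((ν * eLen k ^ 2 : ℝ) : ℂ) • u k t - NSTorus.bconv (NSTorus.nlin k) u k t) t)
    (hdiv : ∀ k, ∀ t ∈ sector, dotK k (u k t) = 0) :
    SolvesNS ν α (velocity vhat u) (fseries (pressureCoeff u)) := by
  intro t x hq
  have hg := hu.goodCoeff hV
  have hp := hu.goodCoeff_pressure hν hV
  have ht : t ∈ sector := hq.1
  have ht0 := ne_zero_of_mem_sector ht
  have hfun : ∀ j, (fun y => velocity vhat u t y j) = fseries (fun k s => u k s j) t := fun j =>
    funext fun y => velocity_apply ht0 y j
  refine ⟨fun j => ?_, ?_⟩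
  · have hd : deriv (fun s => velocity vhat u s x j) t =
        deriv (fun s => fseries (fun k s => u k s j) s x) t := by
      refine Filter.EventuallyEq.deriv_eq ?_
      filter_upwards [isOpen_ne.mem_nhds ht0] with s hs using velocity_apply hs x j
    have hcd : ∀ k, deriv (fun s => u k s j) t =
        -((ν * eLen k ^ 2 : ℝ) : ℂ) * u k t j - NSTorus.bconv (NSTorus.nlin k) u k t j := by
      intro k
      exact ((EuclideanSpace.proj (𝕜 := ℂ) j).hasFDerivAt.comp_hasDerivAt t
        (hderiv k t ht)).deriv
    have h1 := (hg.coord j).hasSum_deriv hν hα hα1 hq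
    have h2 := hasSum_sum (s := Finset.univ) fun l _ =>
      (hg.coord l).hasSum_mul hν hα hα1 ((hg.coord j).dcoeff l) hq
    have h3 := (hp.dcoeff j).hasSum hν hα hα1 hq
    have h4 := (hasSum_sum (s := Finset.univ) fun l _ =>
      (((hg.coord j).dcoeff l).dcoeff l).hasSum hν hα hα1 hq).mul_left (ν : ℂ)
    simp only [hd, hp.pderiv_fseries hν hα hα1 hq, velocity_apply ht0,
      (hg.coord j).pderiv_fseries hν hα hα1 hq, (hg.coord j).pderiv_pderiv_fseries hν hα hα1 hq]
    refine (h1.add h2).unique ((h3.neg.add h4).congr_fun fun k => ?_)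
    have key := hu.sum_conv_eq hν hV ht (fun k => hdiv k t ht) k j
    rw [← Finset.mul_sum, key, hcd, smul_eq_mul]
    have hlap : ∑ l, expI k x * dcoeff l (dcoeff l fun n s => u n s j) k t =
        -(expI k x * (eLen k ^ 2 : ℝ) * u k t j) := by
      rw [eLen_sq]
      push_cast
      rw [Finset.mul_sum, Finset.sum_mul, ← Finset.sum_neg_distrib]
      refine Finset.sum_congr rfl fun l _ => ?_
      simp only [dcoeff]
      linear_combination (expI k x * (k l : ℂ) ^ 2 * u k t j) * Complex.I_mul_I
    rw [hlap]
    simp only [dcoeff]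
    push_cast
    ring
  · have h1 := hasSum_sum (s := Finset.univ) fun l _ =>
      ((hg.coord l).dcoeff l).hasSum hν hα hα1 hq
    simp only [hfun, (hg.coord _).pderiv_fseries hν hα hα1 hq]
    refine h1.unique (hasSum_zero.congr_fun fun k => ?_)
    have h2 := hdiv k t ht
    rw [dotK_apply] at h2
    have : ∑ l, expI k x * dcoeff l (fun n s => u n s l) k t =
        expI k x * Complex.I * ∑ l, (k l : ℂ) * u k t l := by
      rw [Finset.mul_sum]
      refine Finset.sum_congr rfl fun l _ => ?_
      rw [dcoeff]; ring
    rw [this, h2, mul_zero]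

end

/-- Tested on a coordinate vector, where both norms are `1`. -/
lemma le_one_of_forall_mul_norm_le {α : ℝ} (hα : 0 < α)
    (h : ∀ x : Fin 3 → ℂ, α * ‖x‖ ≤ Real.sqrt (∑ j, ‖x j‖ ^ 2)) : α ≤ 1 := by
  have h1 := h (Pi.single 0 1)
  have h2 := norm_le_pi_norm (Pi.single 0 1 : Fin 3 → ℂ) 0
  have h3 : ∑ j, ‖(Pi.single 0 1 : Fin 3 → ℂ) j‖ ^ 2 = 1 := by
    rw [Fin.sum_univ_three]; simp
  rw [h3, Real.sqrt_one] at h1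
  rw [Pi.single_eq_same, norm_one] at h2
  nlinarith

lemma h1Norm_zero {E : Type*} [NormedAddCommGroup E] [NormedSpace ℂ E] :
    h1Norm (0 : (Fin 3 → ℝ) → E) = 0 := by
  simp [h1Norm, coeff]

lemma MemH1.memCH1_const {E : Type*} [NormedAddCommGroup E] [NormedSpace ℂ E]
    {f : (Fin 3 → ℝ) → E} (hf : MemH1 f) : MemCH1 fun _ : ℝ => f where
  mem _ _ := hf
  cont t _ := by simpa [h1Norm_zero] using tendsto_const_nhds
  bounded := lt_of_le_of_lt (iSup₂_le fun _ _ => le_rfl) hf.norm_lt_top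

section

variable {ν α : ℝ} {vhat : (Fin 3 → ℝ) → Vec} {u : (Fin 3 → ℤ) → ℂ → Vec}
  {V : (Fin 3 → ℤ) → ℝ}

lemma MemH1.isH1Seq (h : MemH1 vhat) : IsH1Seq fun k => ‖coeff vhat k‖ :=
  ⟨fun _ => norm_nonneg _, by simp [h.coeff_zero],
    (summable_of_h1Norm_lt_top h.norm_lt_top).congr fun _ => mul_comm _ _⟩

lemma MemH1.energy_le (h : MemH1 vhat) {μ : ℝ} (hμ : 0 ≤ μ)
    (hle : h1Norm vhat ≤ ENNReal.ofReal μ) : energy (fun k => ‖coeff vhat k‖) ≤ μ ^ 2 := by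
  rw [h1Norm_eq (summable_of_h1Norm_lt_top h.norm_lt_top), ENNReal.ofReal_le_ofReal_iff hμ,
    Real.sqrt_le_left hμ] at hle
  refine le_trans (le_of_eq ?_) hle
  exact tsum_congr fun k => mul_comm _ _

/-- Dominated convergence over the modes: the majorant `V` does not depend on `t`, so
coefficientwise limits suffice. -/
lemma tendsto_h1Norm_velocity (hν : 0 < ν) (hvhat : MemH1 vhat) (hu : Majorized ν u V)
    (hV : IsH1Seq V)
    (hlim : ∀ k, Tendsto (u k) (𝓝[sector] 0) (𝓝 (coeff vhat k))) :
    Tendsto (fun t => h1Norm (vhat - onReal (velocity vhat u t))) (𝓝[sector] 0) (𝓝 0) := by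
  have hg := hu.goodCoeff hV
  have hcoeff : ∀ t ∈ sector, ∀ k, coeff (vhat - onReal (velocity vhat u t)) k =
      coeff vhat k - u k t := by
    intro t ht k
    rw [coeff_sub hvhat.integrable, hg.coeff_velocity hν ht]
    rw [hg.onReal_velocity_eq hν ht]
    exact integrable_tsum_expI (hg.summable_norm_coeff hν ht)
  have hbound : Summable fun k => 2 * (‖coeff vhat k‖ ^ 2 * eLen k ^ 2) +
      2 * (eLen k ^ 2 * V k ^ 2) :=
    ((summable_of_h1Norm_lt_top hvhat.norm_lt_top).mul_left 2).add (hV.summable.mul_left 2)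
  have hle : ∀ t ∈ sector, ∀ k, ‖coeff vhat k - u k t‖ ^ 2 * eLen k ^ 2 ≤
      2 * (‖coeff vhat k‖ ^ 2 * eLen k ^ 2) + 2 * (eLen k ^ 2 * V k ^ 2) := by
    intro t ht k
    have h1 : ‖coeff vhat k - u k t‖ ≤ ‖coeff vhat k‖ + V k :=
      (norm_sub_le _ _).trans (add_le_add le_rfl ((hu k).norm_le hν ht))
    have h2 : ‖coeff vhat k - u k t‖ ^ 2 ≤ 2 * ‖coeff vhat k‖ ^ 2 + 2 * V k ^ 2 :=
      (pow_le_pow_left₀ (norm_nonneg _) h1 2).trans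
        (by nlinarith [sq_nonneg (‖coeff vhat k‖ - V k)])
    nlinarith [mul_le_mul_of_nonneg_right h2 (sq_nonneg (eLen k))]
  have hterm : ∀ k, Tendsto (fun t => ‖coeff vhat k - u k t‖ ^ 2 * eLen k ^ 2) (𝓝[sector] 0)
      (𝓝 0) := by
    intro k
    have := ((((hlim k).const_sub (coeff vhat k)).norm).pow 2).mul_const (eLen k ^ 2)
    simpa using this
  have hsum : Tendsto (fun t => ∑' k, ‖coeff vhat k - u k t‖ ^ 2 * eLen k ^ 2) (𝓝[sector] 0)
      (𝓝 0) := by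
    have h := tendsto_tsum_of_dominated_convergence hbound hterm (by
      filter_upwards [self_mem_nhdsWithin] with t ht k
      rw [Real.norm_of_nonneg (by positivity)]
      exact hle t ht k)
    simpa using h
  have h2 : Tendsto (fun t => ENNReal.ofReal
      (Real.sqrt (∑' k, ‖coeff vhat k - u k t‖ ^ 2 * eLen k ^ 2))) (𝓝[sector] 0) (𝓝 0) := by
    have h := (ENNReal.continuous_ofReal.comp Real.continuous_sqrt).tendsto 0
    simp only [Function.comp_apply, Real.sqrt_zero, ENNReal.ofReal_zero] at h
    exact h.comp hsum
  refine h2.congr' ?_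
  filter_upwards [self_mem_nhdsWithin] with t ht
  rw [h1Norm_eq]
  · simp only [hcoeff t ht]
  · simp only [hcoeff t ht]
    exact Summable.of_nonneg_of_le (fun _ => by positivity) (hle t ht) hbound

/-- The field built from a small solution of the integral equations is a global analytic
solution. -/
lemma isAnalyticSolution_velocity (hν : 0 < ν) (hα : 0 < α) (hα1 : α ≤ 1) (hvhat : MemH1 vhat)
    (hdivhat : WeaklyDivFree vhat) (hu : Majorized ν u V) (hV : IsH1Seq V)
    (hfix : ∀ k, ∀ t ∈ sector, u k t = picardStep ν (coeff vhat) u k t) :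
    IsAnalyticSolution ν α vhat (velocity vhat u) := by
  have hg := hu.goodCoeff hV
  have hp := hu.goodCoeff_pressure hν hV
  have hu0 : ∀ t ∈ sector, u 0 t = 0 := fun t ht => by
    have := (hu 0).norm_le hν ht
    rw [hV.zero] at this
    exact norm_le_zero_iff.1 this
  refine ⟨?_, fun t x hq => ?_, ⟨fseries (pressureCoeff u), ?_, fun t x _ j => ?_, ?_⟩,
    Eventually.of_forall fun x => ?_, ?_, ?_⟩
  · exact (hg.differentiableOn hν hα hα1).congr fun q hq => hg.velocity_eq hν hα hα1 hq
  · rw [hg.velocity_eq hν hα hα1 hq]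
    have h : HasSum (fun k => expI k x • u k t) (fseries u t x) :=
      (hg.summable_norm hν hα hα1 hq).of_norm.hasSum
    have h' : HasSum (fun k : {k : Fin 3 → ℤ // k ≠ 0} => expI k x • u k t) (fseries u t x) := by
      refine (hasSum_subtype_iff_of_support_subset (s := {k : Fin 3 → ℤ | k ≠ 0})
        fun k hk => ?_).2 h
      rintro rfl
      exact hk (by simp [hu0 t hq.1])
    simpa only [hg.coeff_velocity hν hq.1] using h'
  · exact hp.differentiableOn hν hα hα1
  · simp only [fseries, expI_add_single]
  · exact hu.solvesNS hν hα hα1 hV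
      (fun k t ht => hasDerivAt_of_eq_picardStep hν hu hV hfix k ht)
      fun k t ht => dotK_eq_zero_of_eq_picardStep hν hu hV hfix
        (hdivhat.dotK_coeff hvhat.integrable) k ht
  · simp [velocity, toC]
  · exact tendsto_h1Norm_velocity hν hvhat hu hV (tendsto_of_eq_picardStep hν hu hV hfix)
  -- The factor `2` passes from the Euclidean norm to `∑ |z_j|`. The resulting majorant is constant
  -- in time.
  · have h2V : IsH1Seq fun k => 2 * V k :=
      ⟨fun k => mul_nonneg zero_le_two (hV.nonneg k), by simp [hV.zero],
        (hV.summable.mul_left 4).congr fun k => by ring⟩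
    obtain ⟨f, hf, hfc⟩ := h2V.exists_memH1
    refine ⟨fun _ => f, hf.memCH1_const, fun t ht k _ => ?_⟩
    rw [hfc, hg.coeff_velocity hν ht, Complex.ofReal_im, Complex.ofReal_re]
    refine ⟨rfl, (sum_norm_le _).trans ?_⟩
    have := (hu k).bound t ht
    rw [decay] at this
    linarith

lemma velocity_im_eq_zero
    (hlim : ∀ k, ∀ t ∈ sector,
      Tendsto (fun n => picardSeq ν (coeff vhat) n k t) atTop (𝓝 (u k t)))
    (hreal : ∀ x j, (vhat x j).im = 0) {t : ℝ} (ht : 0 ≤ t) (x : Fin 3 → ℝ) (j : Fin 3) :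
    (velocity vhat u t (toC x) j).im = 0 := by
  rcases ht.eq_or_lt with rfl | ht
  · simp [velocity, toC, hreal]
  have hts := ofReal_mem_sector ht
  have hconj : ∀ k, u (-k) t = conjV (u k t) := fun k => by
    refine tendsto_nhds_unique (hlim (-k) t hts) ?_
    refine ((conjV.continuous.tendsto _).comp (hlim k t hts)).congr fun n => ?_
    exact (conjV_picardSeq (coeff_neg_of_real hreal) n k t).symm
  rw [velocity_apply (ne_zero_of_mem_sector hts), ← Complex.conj_eq_iff_im, fseries,
    Complex.conj_tsum, ← (Equiv.neg (Fin 3 → ℤ)).tsum_eq]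
  refine tsum_congr fun k => ?_
  rw [Equiv.neg_apply, smul_eq_mul, smul_eq_mul, map_mul, conj_expI_toC, neg_neg, hconj]
  simp

end

/-! ### Existence for small data and exponential decay. -/

/-- Existence of a global analytic solution for small data. -/
lemma exists_analyticSolution {ν : ℝ} (hν : 0 < ν) {α : ℝ} (hα : 0 < α) (hα1 : α ≤ 1)
    {vhat : (Fin 3 → ℝ) → Vec} (hvhat : MemH1 vhat) (hdiv : WeaklyDivFree vhat)
    (hsmall : h1Norm vhat ≤ ENNReal.ofReal (ν / (32 * (latticeSum + 1)))) :
    ∃ v : ℂ → (Fin 3 → ℂ) → Vec, IsAnalyticSolution ν α vhat v ∧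
      ((∀ (x : Fin 3 → ℝ) (j : Fin 3), (vhat x j).im = 0) →
        ∀ t : ℝ, 0 ≤ t → ∀ᵐ x : Fin 3 → ℝ, ∀ j : Fin 3, (v t (toC x) j).im = 0) := by
  have hS := latticeSum_nonneg
  have hE := hvhat.energy_le (by positivity) hsmall
  -- As `16 · 8² = 32²`, the threshold `ν / (32 (S + 1))`, `S = latticeSum`, reduces this to `S ≤ (S
  -- + 1)²`.
  have hs : 16 * (8 / ν) ^ 2 * latticeSum * energy (fun k => ‖coeff vhat k‖) ≤ 1 := by
    calc _ ≤ 16 * (8 / ν) ^ 2 * latticeSum * (ν / (32 * (latticeSum + 1))) ^ 2 := by gcongr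
      _ = latticeSum / (latticeSum + 1) ^ 2 := by field_simp; ring
      _ ≤ 1 := by rw [div_le_one (by positivity)]; nlinarith
  obtain ⟨V, u, hV, hu, hfix, hlim⟩ :=
    exists_picard_limit hν hvhat.isH1Seq (vh := coeff vhat) (fun _ => le_rfl) hs
  exact ⟨velocity vhat u, isAnalyticSolution_velocity hν hα hα1 hvhat hdiv hu hV hfix,
    fun hreal t ht => Eventually.of_forall fun x j =>
      velocity_im_eq_zero hlim hreal ht x j⟩

lemma h1Norm_le_mul {E E' : Type*} [NormedAddCommGroup E] [NormedSpace ℂ E]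
    [NormedAddCommGroup E'] [NormedSpace ℂ E'] {f : (Fin 3 → ℝ) → E} {g : (Fin 3 → ℝ) → E'}
    {c : ℝ} (hc : 0 ≤ c) (h : ∀ k, k ≠ 0 → ‖coeff f k‖ ≤ c * ‖coeff g k‖) :
    h1Norm f ≤ ENNReal.ofReal c * h1Norm g := by
  have h1 : ∑' k, ENNReal.ofReal (‖coeff f k‖ ^ 2 * eLen k ^ 2) ≤
      ENNReal.ofReal (c ^ 2) * ∑' k, ENNReal.ofReal (‖coeff g k‖ ^ 2 * eLen k ^ 2) := by
    rw [← ENNReal.tsum_mul_left]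
    refine ENNReal.tsum_le_tsum fun k => ?_
    rw [← ENNReal.ofReal_mul (sq_nonneg c)]
    refine ENNReal.ofReal_le_ofReal ?_
    rcases eq_or_ne k 0 with rfl | hk
    · simp
    · calc ‖coeff f k‖ ^ 2 * eLen k ^ 2 ≤ (c * ‖coeff g k‖) ^ 2 * eLen k ^ 2 := by
            gcongr; exact h k hk
        _ = _ := by ring
  refine (ENNReal.rpow_le_rpow h1 (by norm_num : (0 : ℝ) ≤ 1 / 2)).trans (le_of_eq ?_)
  rw [ENNReal.mul_rpow_of_nonneg _ _ (by norm_num : (0 : ℝ) ≤ 1 / 2),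
    ENNReal.ofReal_rpow_of_nonneg (sq_nonneg c) (by norm_num), ← Real.sqrt_eq_rpow,
    Real.sqrt_sq hc, h1Norm]

/-- Global analytic solutions decay exponentially in `H¹`. -/
lemma IsAnalyticSolution.exists_h1Norm_le {ν α : ℝ} (hν : 0 < ν) {vhat : (Fin 3 → ℝ) → Vec}
    (hvhat : h1Norm vhat < ⊤) {v : ℂ → (Fin 3 → ℂ) → Vec} (hv : IsAnalyticSolution ν α vhat v) :
    ∃ c : ℝ, 0 < c ∧ ∀ t : ℝ, 0 ≤ t →
      h1Norm (onReal (v t)) ≤ ENNReal.ofReal (c * Real.exp (-(ν * t / 2))) := by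
  obtain ⟨V, hV, hmaj⟩ := hv.majorant
  set B := ⨆ t ∈ Set.Ici (0 : ℝ), h1Norm (V t) with hB
  have hBtop : B ≠ ⊤ := hV.bounded.ne
  refine ⟨B.toReal + (h1Norm vhat).toReal + 1, by positivity, fun t ht => ?_⟩
  rcases ht.eq_or_lt with rfl | ht
  · have : onReal (v ((0 : ℝ) : ℂ)) =ᵐ[volume.restrict cube] vhat := by
      refine ae_restrict_of_ae ?_
      filter_upwards [hv.initial] with x hx
      simpa [onReal] using hx
    rw [h1Norm_congr_ae this]
    refine ENNReal.le_ofReal_iff_toReal_le hvhat.ne (by positivity) |>.2 ?_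
    simp only [mul_zero, zero_div, neg_zero, Real.exp_zero, mul_one]
    linarith [ENNReal.toReal_nonneg (a := B)]
  · have h1 : h1Norm (onReal (v t)) ≤
        ENNReal.ofReal (Real.exp (-(ν * t / 2))) * h1Norm (V t) := by
      refine h1Norm_le_mul (Real.exp_pos _).le fun k hk => ?_
      have h2 := (hmaj t (ofReal_mem_sector ht) k hk).2
      rw [Complex.ofReal_re] at h2
      have h3 := one_le_eLen hk
      calc _ ≤ _ := norm_le_sum _
        _ ≤ _ := h2
        _ ≤ ‖coeff (V t) k‖ * Real.exp (-(ν * t / 2)) := by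
            refine mul_le_mul (Complex.re_le_norm _) ?_ (Real.exp_pos _).le (norm_nonneg _)
            rw [Real.exp_le_exp]
            have := mul_le_mul_of_nonneg_left h3 (mul_pos hν ht).le
            linarith
        _ = _ := mul_comm _ _
    have h2 : h1Norm (V t) ≤ B := le_iSup₂ (f := fun t (_ : t ∈ Set.Ici (0 : ℝ)) => h1Norm (V t))
      t ht.le
    calc _ ≤ _ := h1
      _ ≤ ENNReal.ofReal (Real.exp (-(ν * t / 2))) * ENNReal.ofReal B.toReal := by
          rw [ENNReal.ofReal_toReal hBtop]; gcongr
      _ = ENNReal.ofReal (B.toReal * Real.exp (-(ν * t / 2))) := by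
          rw [← ENNReal.ofReal_mul (Real.exp_pos _).le, mul_comm]
      _ ≤ _ := by
          refine ENNReal.ofReal_le_ofReal (mul_le_mul_of_nonneg_right ?_ (Real.exp_pos _).le)
          linarith [ENNReal.toReal_nonneg (a := h1Norm vhat)]

end

end NSTorus

theorem mainTheorem2 (ν : ℝ) (hν : 0 < ν) :
    ∃ μ : ℝ, 0 < μ ∧
      ∀ α : ℝ, 0 < α → (∀ x : Fin 3 → ℂ, α * ‖x‖ ≤ Real.sqrt (∑ j, ‖x j‖ ^ 2)) →
      ∀ vhat : (Fin 3 → ℝ) → EuclideanSpace ℂ (Fin 3),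
        NSTorus.MemH1 vhat → NSTorus.WeaklyDivFree vhat →
        NSTorus.h1Norm vhat ≤ ENNReal.ofReal μ →
        (∃ v : ℂ → (Fin 3 → ℂ) → EuclideanSpace ℂ (Fin 3),
          NSTorus.IsAnalyticSolution ν α vhat v ∧
          ((∀ (x : Fin 3 → ℝ) (j : Fin 3), (vhat x j).im = 0) →
            ∀ t : ℝ, 0 ≤ t → ∀ᵐ x : Fin 3 → ℝ, ∀ j : Fin 3, (v t (NSTorus.toC x) j).im = 0)) ∧
        ∀ v : ℂ → (Fin 3 → ℂ) → EuclideanSpace ℂ (Fin 3),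
          NSTorus.IsAnalyticSolution ν α vhat v →
          ∃ c : ℝ, 0 < c ∧ ∀ t : ℝ, 0 ≤ t →
            NSTorus.h1Norm (NSTorus.onReal (v t)) ≤
              ENNReal.ofReal (c * Real.exp (-(ν * t / 2))) := by
  have hS := NSTorus.latticeSum_nonneg
  refine ⟨ν / (32 * (NSTorus.latticeSum + 1)), by positivity,
    fun α hα hαn vhat hvhat hdiv hsmall => ⟨?_, fun v hv => ?_⟩⟩
  · exact NSTorus.exists_analyticSolution hν hα (NSTorus.le_one_of_forall_mul_norm_le hα hαn)
      hvhat hdiv hsmall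
  · exact hv.exists_h1Norm_le hν hvhat.norm_lt_top
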